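/- Let $q = R_1 \Join \dots \Join R_n$ be a natural join query in which each relation $R_i$ is binary (over two different attributes, out of $m$ attributes in total). Let $e=(e_1,\dots,e_n)$ be a half-integral fractional edge cover of $q$: $e_i\in\{0,\tfrac12,1\}$, and for each attribute $a$ the weights of the relations whose schema contains $a$ add up to at least $1$. Suppose that the relations with $e_i=\tfrac12$ are exactly the edges of a collection of vertex-disjoint cycles of odd length ($\ge 3$) and that the relations with $e_i=1$ form a union of stars (a star is a set of relations that all contain a common attribute, its center) having no attribute in common with the cycles. An instance assigns to each $R_i$ a finite set of pairs of values; $|R_i|$ is its cardinality, $IN=\sum_i|R_i|$, and $\mathrm{AGM}=\prod_{i=1}^n|R_i|^{e_i}$ (with $0^0=1$). The tuple-attribute graph of the instance has one vertex for each tuple of each relation, one vertex for each value of the active domain, and an edge labelled $R_i.a$ between a tuple of $R_i$ and the value of its attribute $a$. In the vertex-centric BSP model the vertices of this graph and one global aggregation vertex, whose id is known to all vertices, execute the same program in synchronous supersteps. All vertices are active in the first superstep; afterwards a vertex is active if and only if it has received a message. An active vertex computes on its own state, its own data, its incident edges and its received messages, and it sends messages of a constant number of words to vertices whose ids it knows.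 The computation stops when no vertex is active, and its output is the union of the tuples output by the vertices. Local computation is that of a unit-cost random access program with an associative (hash) memory, bounded loops, and addition and comparison of numbers, in which values and vertex ids are opaque. The communication cost is the total number of messages and the computation cost is the total number of steps, over all vertices and supersteps. Then: 1. On each instance, the join result is finite and has at most $\mathrm{AGM}$ tuples. 2. There are a vertex program and a constant $C$, depending only on $q$, $e$ and the decomposition and not on the instance, such that on each instance the program terminates, outputs exactly the join result, and has communication cost and computation cost each at most $C\,(\mathrm{AGM}+IN+1)$. If in addition all relations are non-empty and none is larger than the bound, i.e. $1\le|R_i|\le\mathrm{AGM}$ for all $i$ (for instance if all relations have the same size $N\ge1$), then both costs are at most $C\cdot\mathrm{AGM}=C\prod_{i=1}^n|R_i|^{e_i}$. -/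

import Mathlib

universe u

/-! ### Join queries over binary relations -/

/-- A natural join query with attributes `0, …, m - 1` and binary relations `R 0, …, R (n - 1)`;
the schema of `R i` is `(left i, right i)`, two different attributes. -/
structure BinaryQuery (n m : ℕ) where
  left : Fin n → Fin m
  right : Fin n → Fin m
  left_ne_right : ∀ i, left i ≠ right i

/-- An instance: each relation is a duplicate-free table of pairs of values. -/
structure Database (D : Type u) (n : ℕ) where
  rows : Fin n → List (D × D)
  nodup : ∀ i, (rows i).Nodup

namespace Database

/-- The cardinality `|R i|`. -/
def card {D : Type u} {n : ℕ} (db : Database D n) (i : Fin n) : ℕ := (db.rows i).length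

/-- The input size, i.e. the total number of tuples. -/
def inputSize {D : Type u} {n : ℕ} (db : Database D n) : ℕ := ∑ i, db.card i

/-- The bound `∏ |R i| ^ e i`. -/
noncomputable def agmBound {D : Type u} {n : ℕ} (db : Database D n) (e : Fin n → ℝ) : ℝ :=
  ∏ i, (db.card i : ℝ) ^ (e i)

end Database

namespace BinaryQuery

/-- The natural join of all relations. -/
def join {n m : ℕ} (q : BinaryQuery n m) {D : Type u} (db : Database D n) : Set (Fin m → D) :=
  {t | ∀ i, (t (q.left i), t (q.right i)) ∈ db.rows i}

/-- Nonnegative weights such that each attribute is covered by total weight at least `1`. -/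
def IsFractionalEdgeCover {n m : ℕ} (q : BinaryQuery n m) (e : Fin n → ℝ) : Prop :=
  (∀ i, 0 ≤ e i) ∧
    ∀ a : Fin m, 1 ≤ ∑ i ∈ Finset.univ.filter (fun i => q.left i = a ∨ q.right i = a), e i

/-- The weights are half-integral. -/
def IsHalfIntegral {n : ℕ} (e : Fin n → ℝ) : Prop :=
  ∀ i, e i = 0 ∨ e i = 1 / 2 ∨ e i = 1

/-- A decomposition of the query along the weights `e`: the relations of weight `1/2` are the edges
of vertex-disjoint cycles of odd length, and the relations of weight `1` form a union of stars
that shares no attribute with the cycles. -/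
structure CycleStarDecomposition {n m : ℕ} (q : BinaryQuery n m) (e : Fin n → ℝ) where
  numCycles : ℕ
  /-- Cycle `c` has the odd length `2 * half c + 3`. -/
  half : Fin numCycles → ℕ
  /-- The attributes of a cycle, in cyclic order. -/
  cycleAttr : (c : Fin numCycles) → Fin (2 * half c + 3) → Fin m
  /-- The relations of a cycle, in cyclic order. -/
  cycleRel : (c : Fin numCycles) → Fin (2 * half c + 3) → Fin n
  /-- The attributes of one cycle are distinct, and different cycles are vertex-disjoint. -/
  cycleAttr_injective :
    Function.Injective (fun p : (c : Fin numCycles) × Fin (2 * half c + 3) => cycleAttr p.1 p.2)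
  /-- The `j`-th relation of a cycle joins its attributes `j` and `j + 1` (cyclically). -/
  cycleRel_ends : ∀ c j, s(q.left (cycleRel c j), q.right (cycleRel c j)) =
    s(cycleAttr c j, cycleAttr c (j + 1))
  weight_half_iff : ∀ i, e i = 1 / 2 ↔ ∃ c j, cycleRel c j = i
  numStars : ℕ
  center : Fin numStars → Fin m
  star : Fin numStars → Finset (Fin n)
  /-- All the relations of a star contain its center. (Stars are not required to be disjoint.) -/
  center_mem : ∀ s, ∀ i ∈ star s, q.left i = center s ∨ q.right i = center s
  weight_one_iff : ∀ i, e i = 1 ↔ ∃ s, i ∈ star s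
  cycles_disjoint_stars : ∀ c j, ∀ i, e i = 1 →
    q.left i ≠ cycleAttr c j ∧ q.right i ≠ cycleAttr c j

end BinaryQuery

/-! ### The tuple-attribute graph of an instance -/

/-- Vertices: one for each tuple of each relation, one for each value, and a global aggregation
vertex. -/
inductive Vertex (D : Type u) (n : ℕ) : Type u
  | tuple (i : Fin n) (x y : D) : Vertex D n
  | value (d : D) : Vertex D n
  | aggregator : Vertex D n
  deriving DecidableEq

/-- An edge at a vertex, with label `R i . a` and the vertex at its other end. -/
structure Edge (D : Type u) (n m : ℕ) where
  rel : Fin n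
  attr : Fin m
  target : Vertex D n

namespace Database

variable {D : Type u} [DecidableEq D] {n : ℕ}

/-- The active domain, without repetitions. -/
def activeDomain (db : Database D n) : List D :=
  ((List.finRange n).flatMap fun i => (db.rows i).flatMap fun p => [p.1, p.2]).dedup

/-- The vertices of the tuple-attribute graph, and the aggregation vertex. -/
def vertices (db : Database D n) : List (Vertex D n) :=
  ((List.finRange n).flatMap fun i => (db.rows i).map fun p => Vertex.tuple i p.1 p.2) ++
    db.activeDomain.map Vertex.value ++ [Vertex.aggregator]

/-- The list of the edges at a vertex. Each edge can be used in both directions. -/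
def edges {m : ℕ} (q : BinaryQuery n m) (db : Database D n) :
    Vertex D n → List (Edge D n m)
  | .tuple i x y => [⟨i, q.left i, .value x⟩, ⟨i, q.right i, .value y⟩]
  | .value d => (List.finRange n).flatMap fun i => (db.rows i).flatMap fun p =>
      (if p.1 = d then [⟨i, q.left i, .tuple i p.1 p.2⟩] else []) ++
      (if p.2 = d then [⟨i, q.right i, .tuple i p.1 p.2⟩] else [])
  | .aggregator => []

end Database

/-! ### Local computation at a vertex -/

/-- A machine word holds a number, a vertex id or a data value. Ids and values are opaque:
instructions can copy them, compare them for equality and use them as keys, nothing else. -/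
inductive Word (D : Type u) (n : ℕ) : Type u
  | num (k : ℕ) : Word D n
  | id (v : Vertex D n) : Word D n
  | val (d : D) : Word D n
  deriving DecidableEq

/-- The number in a word (`0` if the word does not hold a number). -/
def Word.toNat {D : Type u} {n : ℕ} : Word D n → ℕ
  | .num k => k
  | _ => 0

/-- Vertex programs: unit-cost random access programs with an associative memory. Registers are
numbered. The keys, message payloads and output tuples occurring in an instruction are lists of
registers of a length that is fixed in the program text, so that each instruction handles a
constant number of words. -/
inductive VertexProgram : Type
  | skip : VertexProgram
  /-- `r := k` -/
  | const (r k : ℕ) : VertexProgram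
  /-- `r := s` -/
  | copy (r s : ℕ) : VertexProgram
  /-- `r := a + b` -/
  | add (r a b : ℕ) : VertexProgram
  /-- `r := memory[key]` -/
  | load (r : ℕ) (key : List ℕ) : VertexProgram
  /-- `memory[key] := s` -/
  | store (key : List ℕ) (s : ℕ) : VertexProgram
  /-- `r :=` the number of the current superstep, from `0` -/
  | superstep (r : ℕ) : VertexProgram
  /-- `r :=` the id of this vertex -/
  | self (r : ℕ) : VertexProgram
  /-- `r :=` the id of the aggregation vertex, which is known to all vertices -/
  | aggregatorId (r : ℕ) : VertexProgram
  /-- `r :=` the label of this vertex -/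
  | label (r : ℕ) : VertexProgram
  /-- `r :=` the `k`-th component of the data stored at this vertex -/
  | datum (r k : ℕ) : VertexProgram
  /-- `r :=` the number of edges at this vertex -/
  | degree (r : ℕ) : VertexProgram
  /-- read the relation name, the attribute name and the target of the edge whose index is in
  register `j` -/
  | edge (rRel rAttr rTarget j : ℕ) : VertexProgram
  /-- `r :=` the number of received messages -/
  | inboxSize (r : ℕ) : VertexProgram
  /-- `r :=` the `k`-th word of the received message whose index is in register `j` -/
  | message (r j k : ℕ) : VertexProgram
  /-- send the payload to the vertex whose id is in register `dst` -/
  | send (dst : ℕ) (payload : List ℕ) : VertexProgram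
  /-- output a tuple -/
  | emit (payload : List ℕ) : VertexProgram
  | seq (s t : VertexProgram) : VertexProgram
  | ifEq (a b : ℕ) (s t : VertexProgram) : VertexProgram
  | ifLe (a b : ℕ) (s t : VertexProgram) : VertexProgram
  /-- `for r = 0, …, b - 1 do s`, with the value of register `b` at the start -/
  | loop (r b : ℕ) (s : VertexProgram) : VertexProgram

/-- What a vertex can read during a superstep, besides its memory. -/
structure LocalView (D : Type u) (n m : ℕ) where
  time : ℕ
  self : Vertex D n
  edges : List (Edge D n m)
  inbox : List (List (Word D n))

namespace LocalView

variable {D : Type u} {n m : ℕ}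

/-- The vertex label: the relation name at a tuple vertex; `n` and `n + 1` stand for the labels
of the value vertices and of the aggregation vertex. -/
def label (V : LocalView D n m) : ℕ :=
  match V.self with
  | .tuple i _ _ => i
  | .value _ => n
  | .aggregator => n + 1

/-- The data stored at the vertex from the beginning: its tuple or its value. -/
def data (V : LocalView D n m) : List (Word D n) :=
  match V.self with
  | .tuple _ x y => [.val x, .val y]
  | .value d => [.val d]
  | .aggregator => []

end LocalView

/-- The local configuration of a vertex in the course of a superstep, with the messages it has
sent, the tuples it has output and the number of steps it has made in this superstep. -/
structure LocalState (D : Type u) (n : ℕ) where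
  reg : ℕ → Word D n
  mem : List (Word D n) → Word D n
  sent : List (Vertex D n × List (Word D n))
  out : List (List (Word D n))
  steps : ℕ

namespace LocalState

variable {D : Type u} {n : ℕ}

/-- At the start of a superstep the registers are cleared; the memory is the vertex state. -/
def start (mem : List (Word D n) → Word D n) : LocalState D n :=
  ⟨fun _ => .num 0, mem, [], [], 0⟩

/-- Count one step. -/
def tick (σ : LocalState D n) : LocalState D n := { σ with steps := σ.steps + 1 }

/-- Assign a word to a register. -/
def set (σ : LocalState D n) (r : ℕ) (w : Word D n) : LocalState D n :=
  { σ with reg := Function.update σ.reg r w }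

/-- Append a message for the vertex `w` is the id of (nothing if `w` is not an id). -/
def post (σ : LocalState D n) (w : Word D n) (payload : List (Word D n)) : LocalState D n :=
  match w with
  | .id v => { σ with sent := σ.sent ++ [(v, payload)] }
  | _ => σ

end LocalState

/-- Execution of a vertex program at one vertex in one superstep. Each instruction, each test and
each iteration of a loop counts as a step. -/
def VertexProgram.exec {D : Type u} [DecidableEq D] {n m : ℕ} (V : LocalView D n m) :
    VertexProgram → LocalState D n → LocalState D n
  | .skip, σ => σ.tick
  | .const r k, σ => (σ.set r (.num k)).tick
  | .copy r s, σ => (σ.set r (σ.reg s)).tick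
  | .add r a b, σ => (σ.set r (.num ((σ.reg a).toNat + (σ.reg b).toNat))).tick
  | .load r key, σ => (σ.set r (σ.mem (key.map σ.reg))).tick
  | .store key s, σ =>
      { σ with mem := Function.update σ.mem (key.map σ.reg) (σ.reg s) }.tick
  | .superstep r, σ => (σ.set r (.num V.time)).tick
  | .self r, σ => (σ.set r (.id V.self)).tick
  | .aggregatorId r, σ => (σ.set r (.id .aggregator)).tick
  | .label r, σ => (σ.set r (.num V.label)).tick
  | .datum r k, σ => (σ.set r (V.data.getD k (.num 0))).tick
  | .degree r, σ => (σ.set r (.num V.edges.length)).tick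
  | .edge rRel rAttr rTarget j, σ =>
      match V.edges[(σ.reg j).toNat]? with
      | some E => (((σ.set rRel (.num E.rel)).set rAttr (.num E.attr)).set rTarget
          (.id E.target)).tick
      | none => σ.tick
  | .inboxSize r, σ => (σ.set r (.num V.inbox.length)).tick
  | .message r j k, σ =>
      (σ.set r ((V.inbox.getD (σ.reg j).toNat []).getD k (.num 0))).tick
  | .send dst payload, σ => (σ.post (σ.reg dst) (payload.map σ.reg)).tick
  | .emit payload, σ => { σ with out := σ.out ++ [payload.map σ.reg] }.tick
  | .seq s t, σ => exec V t (exec V s σ)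
  | .ifEq a b s t, σ => if σ.reg a = σ.reg b then exec V s σ.tick else exec V t σ.tick
  | .ifLe a b s t, σ =>
      if (σ.reg a).toNat ≤ (σ.reg b).toNat then exec V s σ.tick else exec V t σ.tick
  | .loop r b s, σ =>
      (List.range (σ.reg b).toNat).foldl (fun τ i => exec V s (τ.set r (.num i)).tick) σ.tick

/-! ### The vertex-centric bulk synchronous parallel model -/

/-- A global configuration between two supersteps: the number of supersteps made, the state and
the incoming messages of each vertex, and the total communication (number of messages sent),
computation (number of steps) and output so far. -/
structure BSPConfig (D : Type u) (n : ℕ) where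
  time : ℕ
  mem : Vertex D n → List (Word D n) → Word D n
  inbox : Vertex D n → List (List (Word D n))
  communication : ℕ
  computation : ℕ
  output : List (List (Word D n))

namespace BSPConfig

variable {D : Type u} [DecidableEq D] {n m : ℕ}

/-- The initial configuration. -/
def initial : BSPConfig D n := ⟨0, fun _ _ => .num 0, fun _ => [], 0, 0, []⟩

/-- At the beginning all vertices are active, afterwards those that have received a message. -/
def active (db : Database D n) (c : BSPConfig D n) : List (Vertex D n) :=
  db.vertices.filter fun v => c.time = 0 ∨ c.inbox v ≠ []

/-- The computation of a vertex in the next superstep. -/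
def runVertex (q : BinaryQuery n m) (db : Database D n) (P : VertexProgram) (c : BSPConfig D n)
    (v : Vertex D n) : LocalState D n :=
  P.exec ⟨c.time, v, db.edges q v, c.inbox v⟩ (LocalState.start (c.mem v))

/-- The messages sent in the next superstep. -/
def messages (q : BinaryQuery n m) (db : Database D n) (P : VertexProgram) (c : BSPConfig D n) :
    List (Vertex D n × List (Word D n)) :=
  (c.active db).flatMap fun v => (c.runVertex q db P v).sent

/-- One superstep: all active vertices execute the program, and the messages are delivered. -/
def step (q : BinaryQuery n m) (db : Database D n) (P : VertexProgram) (c : BSPConfig D n) :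
    BSPConfig D n where
  time := c.time + 1
  mem v := if v ∈ c.active db then (c.runVertex q db P v).mem else c.mem v
  inbox v := ((c.messages q db P).filter fun p => p.1 = v).map Prod.snd
  communication := c.communication + (c.messages q db P).length
  computation := c.computation + ((c.active db).map fun v => (c.runVertex q db P v).steps).sum
  output := c.output ++ (c.active db).flatMap fun v => (c.runVertex q db P v).out

/-- The configuration after `k` supersteps. -/
def run (q : BinaryQuery n m) (db : Database D n) (P : VertexProgram) (k : ℕ) : BSPConfig D n :=
  (step q db P)^[k] initial

/-- The computation has terminated: there are no active vertices. -/
def Halted (db : Database D n) (c : BSPConfig D n) : Prop := c.active db = []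

/-- The output, i.e. the union of the tuples output by all vertices in all supersteps, is the join
of the relations. -/
def OutputsJoin (q : BinaryQuery n m) (db : Database D n) (c : BSPConfig D n) : Prop :=
  {l | l ∈ c.output} = (fun t : Fin m → D => List.ofFn fun a => Word.val (t a)) '' q.join db

end BSPConfig

/-! Two supersteps suffice. Every vertex sends its row to the aggregation vertex, which costs O(IN +
1) messages; the aggregation vertex then joins the received relations locally. What remains is a
sequential join algorithm with O(AGM + IN + 1) steps.

That algorithm stores each relation in a trie, smaller attribute first, with a constant number of
steps per row (`exec_loadInbox`), and then binds the attributes in increasing order. A node of the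
search tree is a choice of values for the attributes below `k`. If some relation has no tuple
matching these values, the branch is dropped. Otherwise, among the relations containing attribute
`k`, the one offering the fewest candidate values is selected, and all its candidates are tried.

The cost is charged to a potential, `weight`: the product of the numbers of matching tuples raised
to the powers `e i`, replaced by zero at dead ends. The cover condition at attribute `k` enters
through two inequalities. The weights of the children of a live node add up to at most the weight of
the node (`sum_weight_update_le`), by a Hölder inequality for exponents of total weight at least one
(`sum_prod_rpow_le`). The number of children tried is also at most the weight of the node
(`natCast_le_weight`), because a number `c ≥ 1` is at most `c` to the power of the covering weights.
Hence no level has total weight above the weight of the root, which is at most AGM; dead ends are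
paid for by their parents, and each result sits at a leaf of weight at least one. `exec_extendAll`
turns this into an induction on the number of unbound attributes, with a constant that roughly
doubles per level.

The output list is no longer than the weight of the root, so the bound on the size of the join also
comes from this run. -/

/-! ### The fractional edge cover inequality -/

/-- A form of Hölder's inequality for exponents of total weight at least `1`. -/
theorem sum_prod_rpow_le {ι κ : Type*} (S : Finset κ) (I : Finset ι) (a : ι → κ → ℝ) (A e : ι → ℝ)
    (ha : ∀ i ∈ I, ∀ d ∈ S, 0 ≤ a i d) (hA : ∀ i ∈ I, ∑ d ∈ S, a i d ≤ A i)
    (he : ∀ i ∈ I, 0 ≤ e i) (h1 : 1 ≤ ∑ i ∈ I, e i) :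
    ∑ d ∈ S, ∏ i ∈ I, a i d ^ e i ≤ ∏ i ∈ I, A i ^ e i := by
  have hA0 : ∀ i ∈ I, 0 ≤ A i := fun i hi => (Finset.sum_nonneg (ha i hi)).trans (hA i hi)
  have haA : ∀ i ∈ I, ∀ d ∈ S, a i d ≤ A i := fun i hi d hd =>
    (Finset.single_le_sum (ha i hi) hd).trans (hA i hi)
  -- A vanishing `A i` with nonzero exponent kills every summand. Afterwards `A i = 0` only occurs
  -- with exponent zero, where the factor is 1, so the quotients `a i d / A i` are safe.
  by_cases h0 : ∃ i ∈ I, A i = 0 ∧ e i ≠ 0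
  · obtain ⟨i, hi, hAi, hei⟩ := h0
    refine (Finset.sum_nonpos fun d hd => ?_).trans
      (Finset.prod_nonneg fun j hj => Real.rpow_nonneg (hA0 j hj) _)
    refine (Finset.prod_eq_zero hi ?_).le
    rw [le_antisymm ((haA i hi d hd).trans hAi.le) (ha i hi d hd), Real.zero_rpow hei]
  push Not at h0
  set E := ∑ i ∈ I, e i with hE
  have hE0 : 0 < E := by linarith
  have hw : ∑ i ∈ I, e i / E = 1 := by rw [← Finset.sum_div, ← hE, div_self hE0.ne']
  have hw0 : ∀ i ∈ I, 0 ≤ e i / E := fun i hi => div_nonneg (he i hi) hE0.le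
  have hq0 : ∀ i ∈ I, ∀ d ∈ S, 0 ≤ a i d / A i := fun i hi d hd => div_nonneg (ha i hi d hd) (hA0 i hi)
  -- The quotients are at most 1 and `E ≥ 1`, so passing from exponent `e i` to `e i / E` only
  -- increases them. The new exponents sum to 1, and the weighted AM-GM inequality applies for each
  -- `d`.
  have key : ∀ d ∈ S, ∏ i ∈ I, a i d ^ e i ≤
      (∏ i ∈ I, A i ^ e i) * ∑ i ∈ I, e i / E * (a i d / A i) := by
    intro d hd
    calc ∏ i ∈ I, a i d ^ e i ≤ ∏ i ∈ I, (A i ^ e i * (a i d / A i) ^ (e i / E)) := by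
          refine Finset.prod_le_prod (fun i hi => Real.rpow_nonneg (ha i hi d hd) _) fun i hi => ?_
          by_cases hei : e i = 0
          · simp [hei]
          have hAi : 0 < A i := lt_of_le_of_ne (hA0 i hi) fun h => hei (h0 i hi h.symm)
          have hle : a i d / A i ≤ 1 := div_le_one_of_le₀ (haA i hi d hd) hAi.le
          have hpow : (a i d / A i) ^ e i ≤ (a i d / A i) ^ (e i / E) := by
            rcases (hq0 i hi d hd).eq_or_lt with h | h
            · rw [← h, Real.zero_rpow hei]
              exact Real.rpow_nonneg le_rfl _
            · exact Real.rpow_le_rpow_of_exponent_ge h hle (div_le_self (he i hi) h1)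
          calc a i d ^ e i = A i ^ e i * (a i d / A i) ^ e i := by
                rw [← Real.mul_rpow hAi.le (hq0 i hi d hd), mul_div_cancel₀ _ hAi.ne']
            _ ≤ _ := mul_le_mul_of_nonneg_left hpow (Real.rpow_nonneg hAi.le _)
      _ = (∏ i ∈ I, A i ^ e i) * ∏ i ∈ I, (a i d / A i) ^ (e i / E) := Finset.prod_mul_distrib
      _ ≤ _ := mul_le_mul_of_nonneg_left
          (Real.geom_mean_le_arith_mean_weighted I _ _ hw0 hw fun i hi => hq0 i hi d hd)
          (Finset.prod_nonneg fun j hj => Real.rpow_nonneg (hA0 j hj) _)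
  refine (Finset.sum_le_sum key).trans ?_
  rw [← Finset.mul_sum, Finset.sum_comm]
  refine mul_le_of_le_one_right (Finset.prod_nonneg fun j hj => Real.rpow_nonneg (hA0 j hj) _) ?_
  rw [← hw]
  refine Finset.sum_le_sum fun i hi => ?_
  rw [← Finset.mul_sum, ← Finset.sum_div]
  exact mul_le_of_le_one_right (hw0 i hi) (div_le_one_of_le₀ (hA i hi) (hA0 i hi))

/-! ### The potential of a node of the search tree -/

section Weight

variable {ι : Type*} {α : Type*} [DecidableEq α]

/-- The tuples of relation `i` that agree with `t` on the attributes below `k`. -/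
def matching (lo hi : ι → ℕ) (R : ι → Finset (α × α)) (k : ℕ) (t : ℕ → α) (i : ι) :
    Finset (α × α) :=
  (R i).filter fun p => (lo i < k → p.1 = t (lo i)) ∧ (hi i < k → p.2 = t (hi i))

/-- The edge cover bound of the residual query, where the attributes below `k` are bound by `t`. -/
noncomputable def residualBound [Fintype ι] (lo hi : ι → ℕ) (R : ι → Finset (α × α)) (e : ι → ℝ)
    (k : ℕ) (t : ℕ → α) : ℝ :=
  ∏ i, ((matching lo hi R k t i).card : ℝ) ^ e i

open Classical in
/-- The residual bound, set to zero if some relation has no matching tuple. -/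
noncomputable def weight [Fintype ι] (lo hi : ι → ℕ) (R : ι → Finset (α × α)) (e : ι → ℝ)
    (k : ℕ) (t : ℕ → α) : ℝ :=
  if ∀ i, (matching lo hi R k t i).Nonempty then residualBound lo hi R e k t else 0

variable {lo hi : ι → ℕ} {R : ι → Finset (α × α)} {e : ι → ℝ} {k : ℕ} {t : ℕ → α}

theorem matching_congr {t' : ℕ → α} (h : ∀ a < k, t a = t' a) (i : ι) :
    matching lo hi R k t i = matching lo hi R k t' i := by
  refine Finset.filter_congr fun p _ => and_congr ?_ ?_ <;>
    exact forall_congr' fun hlt => by rw [h _ hlt]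

theorem matching_update_of_ne (i : ι) (hlo : lo i ≠ k) (hhi : hi i ≠ k) (d : α) :
    matching lo hi R (k + 1) (Function.update t k d) i = matching lo hi R k t i := by
  refine Finset.filter_congr fun p _ => ?_
  rw [Function.update_of_ne hlo, Function.update_of_ne hhi]
  have h1 : lo i < k + 1 ↔ lo i < k := by omega
  have h2 : hi i < k + 1 ↔ hi i < k := by omega
  rw [h1, h2]

/-- Binding attribute `k` to `d` leaves only matching tuples whose entry at `k` is `d`, and these
fibres are disjoint for different `d`. -/
theorem sum_card_matching_update_le (i : ι) (hk : lo i = k ∨ hi i = k)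
    (S : Finset α) :
    ∑ d ∈ S, (matching lo hi R (k + 1) (Function.update t k d) i).card ≤
      (matching lo hi R k t i).card := by
  rcases hk with hk | hk
  · calc _ ≤ ∑ d ∈ S, ((matching lo hi R k t i).filter fun p => p.1 = d).card := by
          refine Finset.sum_le_sum fun d _ => Finset.card_le_card fun p hp => ?_
          simp only [matching, Finset.mem_filter] at hp ⊢
          refine ⟨⟨hp.1, fun h => by omega, fun h => ?_⟩, ?_⟩
          · rw [hp.2.2 (by omega), Function.update_of_ne (by omega)]
          · rw [hp.2.1 (by omega), hk, Function.update_self]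
      _ ≤ _ := by
          rw [Finset.sum_card_fiberwise_eq_card_filter]
          exact Finset.card_filter_le _ _
  · calc _ ≤ ∑ d ∈ S, ((matching lo hi R k t i).filter fun p => p.2 = d).card := by
          refine Finset.sum_le_sum fun d _ => Finset.card_le_card fun p hp => ?_
          simp only [matching, Finset.mem_filter] at hp ⊢
          refine ⟨⟨hp.1, fun h => ?_, fun h => by omega⟩, ?_⟩
          · rw [hp.2.1 (by omega), Function.update_of_ne (by omega)]
          · rw [hp.2.2 (by omega), hk, Function.update_self]
      _ ≤ _ := by
          rw [Finset.sum_card_fiberwise_eq_card_filter]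
          exact Finset.card_filter_le _ _

variable [Fintype ι]

theorem residualBound_nonneg : 0 ≤ residualBound lo hi R e k t :=
  Finset.prod_nonneg fun _ _ => Real.rpow_nonneg (Nat.cast_nonneg _) _

theorem weight_nonneg : 0 ≤ weight lo hi R e k t := by
  unfold weight
  split_ifs
  exacts [residualBound_nonneg, le_rfl]

theorem weight_le_residualBound : weight lo hi R e k t ≤ residualBound lo hi R e k t := by
  unfold weight
  split_ifs
  exacts [le_rfl, residualBound_nonneg]

theorem weight_congr {t' : ℕ → α} (h : ∀ a < k, t a = t' a) :
    weight lo hi R e k t = weight lo hi R e k t' := by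
  simp only [weight, residualBound, matching_congr h]

theorem residualBound_zero : residualBound lo hi R e 0 t = ∏ i, ((R i).card : ℝ) ^ e i := by
  simp [residualBound, matching]

theorem one_le_weight (he : ∀ i, 0 ≤ e i) (h : ∀ i, (matching lo hi R k t i).Nonempty) :
    1 ≤ weight lo hi R e k t := by
  rw [weight, if_pos h, residualBound, ← Finset.prod_const_one (s := Finset.univ (α := ι))]
  refine Finset.prod_le_prod (fun _ _ => zero_le_one) fun i _ => Real.one_le_rpow ?_ (he i)
  exact_mod_cast (h i).card_pos

/-- Relations without attribute `k` keep their matching tuples, so their factors leave the sum. The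
other factors are handled by `sum_prod_rpow_le`, with exponents of total weight at least 1 by the
cover condition. -/
theorem sum_residualBound_update_le (he : ∀ i, 0 ≤ e i)
    (hcov : 1 ≤ ∑ i ∈ Finset.univ.filter (fun i => lo i = k ∨ hi i = k), e i) (S : Finset α) :
    ∑ d ∈ S, residualBound lo hi R e (k + 1) (Function.update t k d) ≤
      residualBound lo hi R e k t := by
  have hsplit : ∀ f : ι → ℝ, ∏ i, f i =
      (∏ i ∈ Finset.univ.filter (fun i => lo i = k ∨ hi i = k), f i) *
        ∏ i ∈ Finset.univ.filter (fun i => ¬ (lo i = k ∨ hi i = k)), f i := fun f =>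
    (Finset.prod_filter_mul_prod_filter_not _ _ _).symm
  have hrest : ∀ d, ∏ i ∈ Finset.univ.filter (fun i => ¬ (lo i = k ∨ hi i = k)),
        ((matching lo hi R (k + 1) (Function.update t k d) i).card : ℝ) ^ e i =
      ∏ i ∈ Finset.univ.filter (fun i => ¬ (lo i = k ∨ hi i = k)),
        ((matching lo hi R k t i).card : ℝ) ^ e i := by
    refine fun d => Finset.prod_congr rfl fun i hi' => ?_
    rw [Finset.mem_filter, not_or] at hi'
    rw [matching_update_of_ne i hi'.2.1 hi'.2.2]
  simp only [residualBound, hsplit, hrest]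
  rw [← Finset.sum_mul]
  refine mul_le_mul_of_nonneg_right ?_
    (Finset.prod_nonneg fun _ _ => Real.rpow_nonneg (Nat.cast_nonneg _) _)
  refine sum_prod_rpow_le S _
    (fun i d => ((matching lo hi R (k + 1) (Function.update t k d) i).card : ℝ)) _ e
    (fun _ _ _ _ => Nat.cast_nonneg _) (fun i hi' => ?_) (fun i _ => he i) hcov
  exact_mod_cast sum_card_matching_update_le i (Finset.mem_filter.1 hi').2 S

/-- Zeroing dead children only decreases the left side; nonemptiness makes the right side the full
residual bound. This keeps the total weight from growing down the search tree. -/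
theorem sum_weight_update_le (he : ∀ i, 0 ≤ e i)
    (hcov : 1 ≤ ∑ i ∈ Finset.univ.filter (fun i => lo i = k ∨ hi i = k), e i)
    (h : ∀ i, (matching lo hi R k t i).Nonempty) (S : Finset α) :
    ∑ d ∈ S, weight lo hi R e (k + 1) (Function.update t k d) ≤ weight lo hi R e k t := by
  rw [weight, if_pos h]
  exact (Finset.sum_le_sum fun d _ => weight_le_residualBound).trans
    (sum_residualBound_update_le he hcov S)

/-- A number that is at most the number of matching tuples in each relation containing the
attribute `k` is at most the weight. -/
theorem natCast_le_weight (he : ∀ i, 0 ≤ e i)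
    (hcov : 1 ≤ ∑ i ∈ Finset.univ.filter (fun i => lo i = k ∨ hi i = k), e i)
    (h : ∀ i, (matching lo hi R k t i).Nonempty) (c : ℕ)
    (hc : ∀ i, lo i = k ∨ hi i = k → c ≤ (matching lo hi R k t i).card) :
    (c : ℝ) ≤ weight lo hi R e k t := by
  rcases Nat.eq_zero_or_pos c with rfl | hpos
  · exact_mod_cast weight_nonneg
  rw [weight, if_pos h, residualBound,
    ← Finset.prod_filter_mul_prod_filter_not Finset.univ (fun i => lo i = k ∨ hi i = k)]
  have hc1 : (1 : ℝ) ≤ c := by exact_mod_cast hpos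
  -- Monotonicity in the exponent needs base at least 1, hence the separate case `c = 0`. The
  -- remaining relations are nonempty and contribute a factor of at least 1.
  have h1 : (c : ℝ) ≤ ∏ i ∈ Finset.univ.filter (fun i => lo i = k ∨ hi i = k),
      ((matching lo hi R k t i).card : ℝ) ^ e i :=
    calc (c : ℝ) = (c : ℝ) ^ (1 : ℝ) := (Real.rpow_one _).symm
      _ ≤ (c : ℝ) ^ (∑ i ∈ Finset.univ.filter (fun i => lo i = k ∨ hi i = k), e i) :=
          Real.rpow_le_rpow_of_exponent_le hc1 hcov
      _ = ∏ i ∈ Finset.univ.filter (fun i => lo i = k ∨ hi i = k), (c : ℝ) ^ e i :=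
          Real.rpow_sum_of_pos (by linarith) _ _
      _ ≤ _ := by
          refine Finset.prod_le_prod (fun _ _ => Real.rpow_nonneg (by linarith) _) fun i hi' => ?_
          exact Real.rpow_le_rpow (by linarith)
            (by exact_mod_cast hc i (Finset.mem_filter.1 hi').2) (he i)
  have h2 : (1 : ℝ) ≤ ∏ i ∈ Finset.univ.filter (fun i => ¬ (lo i = k ∨ hi i = k)),
      ((matching lo hi R k t i).card : ℝ) ^ e i := by
    rw [← Finset.prod_const_one (s := Finset.univ.filter (fun i => ¬ (lo i = k ∨ hi i = k)))]
    refine Finset.prod_le_prod (fun _ _ => zero_le_one) fun i _ => Real.one_le_rpow ?_ (he i)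
    exact_mod_cast (h i).card_pos
  exact h1.trans (le_mul_of_one_le_right (by linarith) h2)

end Weight

/-! ### A trie in the associative memory -/

section Trie

variable {D : Type u} {n : ℕ}

/-- The memory holds the list `L` of children of node `p` of the trie of relation `w`. -/
def HasChildren (M : List (Word D n) → Word D n) (w : Word D n) (p L : List (Word D n)) : Prop :=
  M (.num 0 :: w :: p) = .num L.length ∧
    ∀ j (hj : j < L.length), M (.num 1 :: w :: (p ++ [.num j])) = L[j]

/-- The memory holds a trie of depth two for each of the relations `T w`. -/
def StoresTrie (M : List (Word D n) → Word D n) (T : Word D n → Word D n → Word D n → Prop) :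
    Prop :=
  (∀ w, ∃ L, HasChildren M w [] L ∧ L.Nodup ∧ ∀ x, x ∈ L ↔ ∃ y, T w x y) ∧
  (∀ w x, ∃ L, HasChildren M w [x] L ∧ L.Nodup ∧ ∀ y, y ∈ L ↔ T w x y) ∧
  ∀ w x y, (T w x y → M [.num 0, w, x, y] = .num 1) ∧ (¬ T w x y → M [.num 0, w, x, y] = .num 0)

/-- Cleared memory answers 0 at every key, which reads as child count 0 and as an absent leaf; no
initialisation is needed. -/
theorem storesTrie_empty :
    StoresTrie (fun _ => (.num 0 : Word D n)) fun _ _ _ => False := by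
  refine ⟨fun w => ⟨[], ?_⟩, fun w x => ⟨[], ?_⟩, fun w x y => ?_⟩ <;> simp [HasChildren]

variable [DecidableEq D]

/-- Append the child `z` to node `p`, which has `c` children. -/
def appendChild (M : List (Word D n) → Word D n) (w : Word D n) (p : List (Word D n))
    (c : ℕ) (z : Word D n) : List (Word D n) → Word D n :=
  Function.update (Function.update M (.num 1 :: w :: (p ++ [.num c])) z)
    (.num 0 :: w :: p) (.num (c + 1))

theorem HasChildren.appendChild_self {M : List (Word D n) → Word D n} {w : Word D n}
    {p L : List (Word D n)} (h : HasChildren M w p L) (z : Word D n) :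
    HasChildren (appendChild M w p L.length z) w p (L ++ [z]) := by
  refine ⟨by simp [appendChild], fun j hj => ?_⟩
  rw [List.length_append, List.length_singleton] at hj
  rw [appendChild, Function.update_of_ne (by simp)]
  rcases (Nat.lt_succ_iff.1 hj).eq_or_lt with rfl | hlt
  · simp
  · rw [Function.update_of_ne (by simp; omega), h.2 j hlt, List.getElem_append_left hlt]

/-- The leading word separates counts (0) from children (1), and stripping the index at the end of a
child key recovers the node, so keys of different nodes never collide. -/
theorem HasChildren.appendChild_of_ne {M : List (Word D n) → Word D n} {w w' : Word D n}
    {p p' L : List (Word D n)} (h : HasChildren M w p L) (c : ℕ) (z : Word D n)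
    (hne : w' :: p' ≠ w :: p) : HasChildren (appendChild M w' p' c z) w p L := by
  have hne' : w :: p ≠ w' :: p' := hne.symm
  refine ⟨?_, fun j hj => ?_⟩
  · rw [appendChild, Function.update_of_ne (fun h => hne' (List.cons.inj h).2),
      Function.update_of_ne (by simp), h.1]
  · rw [appendChild, Function.update_of_ne (by simp), Function.update_of_ne, h.2 j hj]
    intro h
    have h := (List.cons.inj h).2
    rw [← List.cons_append, ← List.cons_append] at h
    exact hne' (List.append_inj' h rfl).1

/-- A leaf flag shares the leading word 0 with the counts, but its key has four words, while counts
at depth at most one have at most three. -/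
theorem HasChildren.update_leaf {M : List (Word D n) → Word D n} {w : Word D n}
    {p L : List (Word D n)} (h : HasChildren M w p L) (hp : p.length ≤ 1) (w' x y z : Word D n) :
    HasChildren (Function.update M [.num 0, w', x, y] z) w p L := by
  refine ⟨?_, fun j hj => ?_⟩
  · rw [Function.update_of_ne, h.1]
    intro h
    have := congrArg List.length h
    simp at this
    omega
  · rw [Function.update_of_ne (by simp), h.2 j hj]

/-- Insert the row `(x, y)` into the trie of relation `w`. The registers `z` and `o` hold `0` and
`1`, and the registers `s` and `s + 1` are scratch. -/
def insertRow (z o w x y s : ℕ) : VertexProgram :=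
  .seq (.load s [z, w, x]) <|
  .seq (.ifEq s z
    (.seq (.load (s + 1) [z, w]) <| .seq (.store [o, w, s + 1] x) <|
      .seq (.add (s + 1) (s + 1) o) (.store [z, w] (s + 1))) .skip) <|
  .seq (.store [o, w, x, s] y) <| .seq (.add s s o) <| .seq (.store [z, w, x] s)
    (.store [z, w, x, y] o)

open Classical in
/-- The effect of inserting a row on the memory. -/
noncomputable def insertMem (M : List (Word D n) → Word D n) (w x y : Word D n) :
    List (Word D n) → Word D n :=
  Function.update (appendChild
    (if M [.num 0, w, x] = .num 0 then appendChild M w [] (M [.num 0, w]).toNat x else M) w [x]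
    (M [.num 0, w, x]).toNat y) [.num 0, w, x, y] (.num 1)

/-- A value `x` is already below the root exactly when it has a child, so testing its child count
for zero decides whether to append it. Newness of the row keeps the list below `x` free of
duplicates. -/
theorem StoresTrie.insertMem {M : List (Word D n) → Word D n}
    {T : Word D n → Word D n → Word D n → Prop} (h : StoresTrie M T) {w x y : Word D n}
    (hnew : ¬ T w x y) :
    StoresTrie (insertMem M w x y) fun a b c => T a b c ∨ (a = w ∧ b = x ∧ c = y) := by
  obtain ⟨h0, h1, h2⟩ := h
  -- `M'` is the memory after the optional insertion at the root: the lists at depth one and the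
  -- leaf flags are untouched, and the root list of `w` contains `x`.
  have hM : ∃ M', (if M [.num 0, w, x] = .num 0 then
      appendChild M w [] (M [.num 0, w]).toNat x else M) = M' ∧
      (∀ a b L, HasChildren M a [b] L → HasChildren M' a [b] L) ∧
      (∀ a b c, M' [.num 0, a, b, c] = M [.num 0, a, b, c]) ∧
      ∀ a, ∃ L, HasChildren M' a [] L ∧ L.Nodup ∧
        ∀ b, b ∈ L ↔ (∃ c, T a b c) ∨ a = w ∧ b = x := by
    obtain ⟨B, hB, -, hBm⟩ := h1 w x
    have hB0 : M [.num 0, w, x] = .num B.length := hB.1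
    split_ifs with hc
    · rw [hB0, Word.num.injEq, List.length_eq_zero_iff] at hc
      subst hc
      refine ⟨_, rfl, fun a b L hL => hL.appendChild_of_ne _ _ (by simp), fun a b c => ?_,
        fun a => ?_⟩
      · simp [appendChild]
      · obtain ⟨A, hA, hAn, hAm⟩ := h0 a
        by_cases haw : a = w
        · subst haw
          have hA0 : M [.num 0, a] = .num A.length := hA.1
          refine ⟨A ++ [x], ?_, ?_, fun b => ?_⟩
          · rw [hA0]
            exact hA.appendChild_self x
          · refine List.nodup_append.2 ⟨hAn, List.nodup_singleton _, ?_⟩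
            rintro b hb _ hx rfl
            rw [List.mem_singleton.1 hx] at hb
            obtain ⟨c, hc⟩ := (hAm x).1 hb
            simpa using (hBm c).2 hc
          · simp [hAm]
        · refine ⟨A, hA.appendChild_of_ne _ _ ?_, hAn, fun b => ?_⟩
          · simpa using Ne.symm haw
          · simp [hAm, haw]
    · refine ⟨_, rfl, fun a b L hL => hL, fun _ _ _ => rfl, fun a => ?_⟩
      obtain ⟨A, hA, hAn, hAm⟩ := h0 a
      refine ⟨A, hA, hAn, fun b => ?_⟩
      rw [hAm]
      refine ⟨Or.inl, ?_⟩
      rintro (h | ⟨rfl, rfl⟩)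
      · exact h
      · rw [hB0, Word.num.injEq, List.length_eq_zero_iff] at hc
        obtain ⟨c, hc⟩ := List.exists_mem_of_ne_nil _ hc
        exact ⟨c, (hBm c).1 hc⟩
  obtain ⟨M', hM', k1, k2, k0⟩ := hM
  have hins : _root_.insertMem M w x y =
      Function.update (appendChild M' w [x] (M [.num 0, w, x]).toNat y) [.num 0, w, x, y]
        (.num 1) := by
    rw [_root_.insertMem, ← hM']
  rw [hins]
  refine ⟨fun a => ?_, fun a b => ?_, fun a b c => ?_⟩
  · obtain ⟨L, hL, hn, hm⟩ := k0 a
    refine ⟨L, (hL.appendChild_of_ne _ _ (by simp)).update_leaf (by simp) _ _ _ _, hn, fun b => ?_⟩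
    rw [hm]
    constructor
    · rintro (⟨c, hc⟩ | ⟨rfl, rfl⟩)
      exacts [⟨c, .inl hc⟩, ⟨y, .inr ⟨rfl, rfl, rfl⟩⟩]
    · rintro ⟨c, hc | ⟨rfl, rfl, rfl⟩⟩
      exacts [.inl ⟨c, hc⟩, .inr ⟨rfl, rfl⟩]
  · obtain ⟨L, hL, hn, hm⟩ := h1 a b
    by_cases hab : a = w ∧ b = x
    · obtain ⟨rfl, rfl⟩ := hab
      refine ⟨L ++ [y], ?_, ?_, fun c => by simp [hm]⟩
      · rw [show M [.num 0, a, b] = .num L.length from hL.1]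
        exact ((k1 _ _ _ hL).appendChild_self y).update_leaf (by simp) _ _ _ _
      · refine List.nodup_append.2 ⟨hn, List.nodup_singleton _, ?_⟩
        rintro c hc _ hy rfl
        rw [List.mem_singleton.1 hy] at hc
        exact hnew ((hm y).1 hc)
    · refine ⟨L, ((k1 _ _ _ hL).appendChild_of_ne _ _ ?_).update_leaf (by simp) _ _ _ _, hn,
        fun c => ?_⟩
      · intro h
        simp only [List.cons.injEq, and_true] at h
        exact hab ⟨h.1.symm, h.2.symm⟩
      · rw [hm]
        exact ⟨.inl, fun h => h.elim id fun h => absurd ⟨h.1, h.2.1⟩ hab⟩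
  · by_cases habc : a = w ∧ b = x ∧ c = y
    · obtain ⟨rfl, rfl, rfl⟩ := habc
      simp
    · have hval : Function.update (appendChild M' w [x] (M [.num 0, w, x]).toNat y)
          [.num 0, w, x, y] (.num 1) [.num 0, a, b, c] = M [.num 0, a, b, c] := by
        rw [Function.update_of_ne (by simpa using habc), appendChild,
          Function.update_of_ne (by simp), Function.update_of_ne (by simp), k2]
      rw [hval]
      simpa [habc] using h2 a b c

variable {m : ℕ}

/-- The program uses the loaded count itself as a key, while `insertMem` rebuilds it from its
numerical value; `ha` and `hb` make the two agree. -/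
theorem exec_insertRow (V : LocalView D n m) (σ : LocalState D n) {z o w x y s : ℕ}
    (hz : σ.reg z = .num 0) (ho : σ.reg o = .num 1)
    (hs : z < s ∧ o < s ∧ w < s ∧ x < s ∧ y < s) {a b : ℕ}
    (ha : σ.mem [.num 0, σ.reg w] = .num a) (hb : σ.mem [.num 0, σ.reg w, σ.reg x] = .num b) :
    ((insertRow z o w x y s).exec V σ).mem = insertMem σ.mem (σ.reg w) (σ.reg x) (σ.reg y) ∧
    ((insertRow z o w x y s).exec V σ).sent = σ.sent ∧
    ((insertRow z o w x y s).exec V σ).out = σ.out ∧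
    (∀ r < s, ((insertRow z o w x y s).exec V σ).reg r = σ.reg r) ∧
    ((insertRow z o w x y s).exec V σ).steps ≤ σ.steps + 10 := by
  obtain ⟨h1, h2, h3, h4, h5⟩ := hs
  have e1 : z ≠ s := by omega
  have e2 : o ≠ s := by omega
  have e3 : w ≠ s := by omega
  have e4 : x ≠ s := by omega
  have e5 : y ≠ s := by omega
  have e1' : z ≠ s + 1 := by omega
  have e2' : o ≠ s + 1 := by omega
  have e3' : w ≠ s + 1 := by omega
  have e4' : x ≠ s + 1 := by omega
  have e5' : y ≠ s + 1 := by omega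
  by_cases hc : b = 0
  · refine ⟨?_, ?_, ?_, fun r hr => ?_, ?_⟩
    · simp [insertRow, VertexProgram.exec, LocalState.set, LocalState.tick, insertMem, appendChild,
        Function.update_of_ne, *, Word.toNat]
    · simp [insertRow, VertexProgram.exec, LocalState.set, LocalState.tick, *]
    · simp [insertRow, VertexProgram.exec, LocalState.set, LocalState.tick, *]
    · have : r ≠ s := by omega
      have : r ≠ s + 1 := by omega
      simp [insertRow, VertexProgram.exec, LocalState.set, LocalState.tick, *]
    · simp [insertRow, VertexProgram.exec, LocalState.set, LocalState.tick, *]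
  · refine ⟨?_, ?_, ?_, fun r hr => ?_, ?_⟩
    · simp [insertRow, VertexProgram.exec, LocalState.set, LocalState.tick, insertMem, appendChild,
        Function.update_of_ne, *, Word.toNat]
    · simp [insertRow, VertexProgram.exec, LocalState.set, LocalState.tick, *]
    · simp [insertRow, VertexProgram.exec, LocalState.set, LocalState.tick, *]
    · have : r ≠ s := by omega
      have : r ≠ s + 1 := by omega
      simp [insertRow, VertexProgram.exec, LocalState.set, LocalState.tick, *]
    · simp [insertRow, VertexProgram.exec, LocalState.set, LocalState.tick, *]

/-- Insert all received messages `[w, x, y]`, using the registers from `s` on as scratch. -/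
def loadInbox (z o s : ℕ) : VertexProgram :=
  .seq (.inboxSize s) <| .loop (s + 1) s <|
    .seq (.message (s + 2) (s + 1) 0) <| .seq (.message (s + 3) (s + 1) 1) <|
    .seq (.message (s + 4) (s + 1) 2) (insertRow z o (s + 2) (s + 3) (s + 4) (s + 5))

theorem exec_loadInbox (V : LocalView D n m) (T : List (Word D n × Word D n × Word D n))
    (hV : V.inbox = T.map fun p => [p.1, p.2.1, p.2.2]) (hT : T.Nodup)
    (σ : LocalState D n) {z o s : ℕ} (hz : σ.reg z = .num 0) (ho : σ.reg o = .num 1)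
    (hzs : z < s) (hos : o < s) (hmem : σ.mem = fun _ => .num 0) :
    StoresTrie ((loadInbox z o s).exec V σ).mem (fun w x y => (w, x, y) ∈ T) ∧
    ((loadInbox z o s).exec V σ).sent = σ.sent ∧
    ((loadInbox z o s).exec V σ).out = σ.out ∧
    (∀ r < s, ((loadInbox z o s).exec V σ).reg r = σ.reg r) ∧
    ((loadInbox z o s).exec V σ).steps ≤ σ.steps + 2 + 14 * T.length := by
  set body : VertexProgram := .seq (.message (s + 2) (s + 1) 0) <|
    .seq (.message (s + 3) (s + 1) 1) <| .seq (.message (s + 4) (s + 1) 2)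
    (insertRow z o (s + 2) (s + 3) (s + 4) (s + 5)) with hbody
  -- Loop invariant after `c` messages. The 14 steps are one for the iteration, three for reading
  -- the message and at most ten for the insertion.
  have key : ∀ τ : LocalState D n, τ.mem = (fun _ => .num 0) → (∀ r < s, τ.reg r = σ.reg r) →
      ∀ c ≤ T.length, ∃ τ', (List.range c).foldl
        (fun τ i => body.exec V (τ.set (s + 1) (.num i)).tick) τ = τ' ∧
        StoresTrie τ'.mem (fun w x y => (w, x, y) ∈ T.take c) ∧ τ'.sent = τ.sent ∧
        τ'.out = τ.out ∧ (∀ r < s, τ'.reg r = σ.reg r) ∧ τ'.steps ≤ τ.steps + 14 * c := by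
    intro τ hτm hτr c
    induction c with
    | zero =>
      intro _
      refine ⟨τ, rfl, ?_, rfl, rfl, hτr, le_rfl⟩
      rw [hτm]
      simpa using storesTrie_empty
    | succ c ih =>
      intro hc
      obtain ⟨τ₁, h1, h2, h3, h4, h5, h6⟩ := ih (by omega)
      rw [List.range_succ, List.foldl_append, h1, List.foldl_cons, List.foldl_nil]
      have hin : V.inbox[c]?.getD [] = [T[c].1, T[c].2.1, T[c].2.2] := by
        rw [hV, List.getElem?_eq_getElem (by simpa using hc)]
        simp
      set ρ : LocalState D n := ⟨Function.update (Function.update (Function.update (Function.update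
        τ₁.reg (s + 1) (.num c)) (s + 2) T[c].1) (s + 3) T[c].2.1) (s + 4) T[c].2.2,
        τ₁.mem, τ₁.sent, τ₁.out, τ₁.steps + 4⟩ with hρ
      have hρr : ∀ r < s, ρ.reg r = σ.reg r := fun r hr => by
        simp only [hρ]
        rw [Function.update_of_ne (by omega), Function.update_of_ne (by omega),
          Function.update_of_ne (by omega), Function.update_of_ne (by omega), h5 r hr]
      have hex : body.exec V (τ₁.set (s + 1) (.num c)).tick =
          (insertRow z o (s + 2) (s + 3) (s + 4) (s + 5)).exec V ρ := by
        simp [hbody, VertexProgram.exec, LocalState.set, LocalState.tick, Word.toNat, hin, hρ]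
      obtain ⟨A, ha, -⟩ := h2.1 (ρ.reg (s + 2))
      obtain ⟨B, hb, -⟩ := h2.2.1 (ρ.reg (s + 2)) (ρ.reg (s + 3))
      obtain ⟨g1, g2, g3, g4, g5⟩ := exec_insertRow V ρ (z := z) (o := o) (w := s + 2) (x := s + 3)
        (y := s + 4) (s := s + 5) (by rw [hρr z hzs, hz]) (by rw [hρr o hos, ho])
        (by omega)
        (ha := ha.1) (hb := hb.1)
      have w1 : ρ.reg (s + 2) = T[c].1 := by simp [hρ]
      have w2 : ρ.reg (s + 3) = T[c].2.1 := by simp [hρ]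
      have w3 : ρ.reg (s + 4) = T[c].2.2 := by simp [hρ]
      have htake : T.take (c + 1) = T.take c ++ [T[c]] := by simp
      refine ⟨_, rfl, ?_, ?_, ?_, fun r hr => ?_, ?_⟩
      · rw [hex, g1, w1, w2, w3]
        have hnew : ¬ (T[c].1, T[c].2.1, T[c].2.2) ∈ T.take c := by
          have := hT.sublist (List.take_sublist (c + 1) T)
          rw [htake, List.nodup_append] at this
          exact fun hmem => this.2.2 _ hmem T[c] (by simp) rfl
        have := h2.insertMem hnew
        simp only [htake, List.mem_append, List.mem_singleton]
        convert this using 6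
        simp [Prod.ext_iff]
      · rw [hex, g2, ← h3]
      · rw [hex, g3, ← h4]
      · rw [hex, g4 r (by omega), hρr r hr]
      · rw [hex]
        refine g5.trans ?_
        simp only [hρ]
        omega
  obtain ⟨τ', h1, h2, h3, h4, h5, h6⟩ := key ((σ.set s (.num V.inbox.length)).tick).tick hmem
    (fun r hr => by
      simp only [LocalState.tick, LocalState.set]
      rw [Function.update_of_ne (by omega)]) T.length le_rfl
  have hex : (loadInbox z o s).exec V σ = τ' := by
    rw [← h1]
    simp [loadInbox, VertexProgram.exec, ← hbody, hV, LocalState.set, LocalState.tick, Word.toNat]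
  rw [hex]
  rw [List.take_length] at h2
  refine ⟨h2, h3, h4, h5, h6.trans ?_⟩
  simp only [LocalState.tick, LocalState.set]
  omega

end Trie

/-! ### The attribute-at-a-time join of relations stored as tries -/

/-- The registers with the key of the number of tuples of relation `i` under the bound
attributes. Attribute `a` is in register `a < m`, and the number `j` is in register `m + n + j`. -/
def countKey {n : ℕ} (m : ℕ) (lo hi : Fin n → ℕ) (k : ℕ) (i : Fin n) : List ℕ :=
  (m + n) :: (m + n + i) ::
    (if hi i < k then [lo i, hi i] else if lo i < k then [lo i] else [])

/-- The registers with the key of the candidate for attribute `k` whose index is in register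
`k`. -/
def childKey {n : ℕ} (m : ℕ) (lo : Fin n → ℕ) (k : ℕ) (i : Fin n) : List ℕ :=
  (m + n + 1) :: (m + n + i) :: ((if lo i < k then [lo i] else []) ++ [k])

/-- Load the counts of the relations and execute `body` if none of them is zero. -/
def guardCounts {n : ℕ} (m : ℕ) (lo hi : Fin n → ℕ) (k : ℕ) (body : VertexProgram) :
    List (Fin n) → VertexProgram
  | [] => body
  | i :: l => .seq (.load (m + i) (countKey m lo hi k i))
      (.ifEq (m + i) (m + n) .skip (guardCounts m lo hi k body l))

/-- Execute `f i` for a relation `i` with the least count. -/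
def chooseLeast {n : ℕ} (m : ℕ) (f : Fin n → VertexProgram) (best : Fin n) :
    List (Fin n) → VertexProgram
  | [] => f best
  | j :: l => .ifLe (m + best) (m + j) (chooseLeast m f best l) (chooseLeast m f j l)

/-- Try all candidates for attribute `k` that relation `i` provides. -/
def tryCandidates {n : ℕ} (m : ℕ) (lo : Fin n → ℕ) (k : ℕ) (body : VertexProgram) (i : Fin n) :
    VertexProgram :=
  .loop k (m + i) (.seq (.load k (childKey m lo k i)) body)

/-- The relations that contain attribute `k`. -/
def containing {n : ℕ} (lo hi : Fin n → ℕ) (k : ℕ) : List (Fin n) :=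
  (List.finRange n).filter fun i => lo i = k ∨ hi i = k

/-- Output all join results that extend the values of the attributes below `k`; there are `r`
more attributes. -/
def extendAll {n : ℕ} (m : ℕ) (lo hi : Fin n → ℕ) : ℕ → ℕ → VertexProgram
  | 0, k => guardCounts m lo hi k (.emit (List.range m)) (List.finRange n)
  | r + 1, k => guardCounts m lo hi k
      (match containing lo hi k with
      | [] => .skip
      | i :: l => chooseLeast m (tryCandidates m lo k (extendAll m lo hi r (k + 1))) i l)
      (List.finRange n)

/-- The cost of `extendAll` relative to the weight. -/
def extendCost (n : ℕ) : ℕ → ℕ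
  | 0 => 2 * n + 2
  | r + 1 => 3 * n + 4 + 2 * extendCost n r

/-! ### Correctness and cost of the search -/

section Extend

variable {D : Type u} {n m : ℕ}

/-- The part of the state that is invariant while attributes from `k` on are bound. -/
structure Keeps (m k : ℕ) (σ τ : LocalState D n) : Prop where
  mem : τ.mem = σ.mem
  sent : τ.sent = σ.sent
  reg : ∀ r, r < k ∨ m + n ≤ r → τ.reg r = σ.reg r

theorem Keeps.refl (m k : ℕ) (σ : LocalState D n) : Keeps m k σ σ := ⟨rfl, rfl, fun _ _ => rfl⟩

theorem Keeps.trans {k : ℕ} {σ τ ρ : LocalState D n} (h : Keeps m k σ τ) (h' : Keeps m k τ ρ) :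
    Keeps m k σ ρ :=
  ⟨h'.mem.trans h.mem, h'.sent.trans h.sent, fun r hr => (h'.reg r hr).trans (h.reg r hr)⟩

theorem Keeps.mono {k k' : ℕ} {σ τ : LocalState D n} (h : Keeps m k σ τ) (hk : k' ≤ k) :
    Keeps m k' σ τ :=
  ⟨h.mem, h.sent, fun r hr => h.reg r (by omega)⟩

/-- The constants are in place, and the memory holds tries of the relations. -/
structure Ready (m : ℕ) (R : Fin n → Finset (Word D n × Word D n)) (σ : LocalState D n) :
    Prop where
  const : ∀ j < n + 2, σ.reg (m + n + j) = .num j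
  trie : ∃ T, StoresTrie σ.mem T ∧ ∀ (i : Fin n) x y, T (.num i) x y ↔ (x, y) ∈ R i

theorem Ready.of_keeps {R : Fin n → Finset (Word D n × Word D n)} {σ τ : LocalState D n} {k : ℕ}
    (h : Ready m R σ) (hk : Keeps m k σ τ) : Ready m R τ :=
  ⟨fun j hj => by rw [hk.reg _ (by omega), h.const j hj], by rw [hk.mem]; exact h.trie⟩

/-- The count of relation `i` under the bound attributes, as found in the memory. -/
def count (m : ℕ) (lo hi : Fin n → ℕ) (k : ℕ) (σ : LocalState D n) (i : Fin n) : ℕ :=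
  (σ.mem ((countKey m lo hi k i).map σ.reg)).toNat

variable {lo hi : Fin n → ℕ} {R : Fin n → Finset (Word D n × Word D n)}

theorem Keeps.count_eq {k : ℕ} {σ τ : LocalState D n} (h : Keeps m k σ τ)
    (hlh : ∀ i, lo i < hi i) (i : Fin n) :
    count m lo hi k τ i = count m lo hi k σ i := by
  unfold count
  rw [h.mem]
  congr 2
  refine List.map_congr_left fun r hr => h.reg r ?_
  have := hlh i
  unfold countKey at hr
  split_ifs at hr <;> simp at hr <;> omega

/-- The join results that extend the values below `k`, as output tuples. -/
def IsExtension (m : ℕ) (lo hi : Fin n → ℕ) (R : Fin n → Finset (Word D n × Word D n)) (k : ℕ)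
    (t : ℕ → Word D n) (l : List (Word D n)) : Prop :=
  ∃ s : ℕ → Word D n, (∀ a < k, s a = t a) ∧ (∀ i, (s (lo i), s (hi i)) ∈ R i) ∧
    l = (List.range m).map s

theorem isExtension_congr {k : ℕ} {t t' : ℕ → Word D n} (h : ∀ a < k, t a = t' a)
    (l : List (Word D n)) : IsExtension m lo hi R k t l ↔ IsExtension m lo hi R k t' l := by
  refine exists_congr fun s => and_congr_left fun _ => forall_congr' fun a => forall_congr' fun ha => ?_
  rw [h a ha]

variable [DecidableEq D]

/-- Since `lo i < hi i`, the bound attributes of a relation are both, the smaller one, or none, and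
the count is read at a leaf, at depth one, or at the root. It counts distinct values of the next
attribute (or is a 0/1 flag), hence it is at most the number of matching tuples and vanishes exactly
when there are none. If `k` belongs to the relation, it is this next attribute, and the children are
the candidates. -/
theorem Ready.count_spec {σ : LocalState D n} (h : Ready m R σ) (hlh : ∀ i, lo i < hi i)
    (k : ℕ) (i : Fin n) :
    σ.mem ((countKey m lo hi k i).map σ.reg) = .num (count m lo hi k σ i) ∧
    (count m lo hi k σ i ≠ 0 ↔ (matching lo hi R k σ.reg i).Nonempty) ∧
    count m lo hi k σ i ≤ (matching lo hi R k σ.reg i).card ∧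
    (lo i = k ∨ hi i = k → ∃ L : List (Word D n), L.Nodup ∧ L.length = count m lo hi k σ i ∧
      (∀ p ∈ matching lo hi R k σ.reg i, (lo i = k → p.1 ∈ L) ∧ (hi i = k → p.2 ∈ L)) ∧
      ∀ j (hj : j < L.length) (g : ℕ → Word D n), (∀ r, r < k ∨ m + n ≤ r → g r = σ.reg r) →
        g k = .num j → σ.mem ((childKey m lo k i).map g) = L[j]) := by
  obtain ⟨T, ⟨h0, h1, h2⟩, hT⟩ := h.trie
  have c0 : σ.reg (m + n) = .num 0 := h.const 0 (by omega)
  have c1 : σ.reg (m + n + 1) = .num 1 := h.const 1 (by omega)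
  have ci : σ.reg (m + n + i) = .num i := h.const i (by omega)
  have hlt := hlh i
  by_cases hhi : hi i < k
  · have hlo : lo i < k := by omega
    have hm : matching lo hi R k σ.reg i =
        (R i).filter fun p => p = (σ.reg (lo i), σ.reg (hi i)) := by
      refine Finset.filter_congr fun p _ => ?_
      simp [hlo, hhi, Prod.ext_iff]
    have hval : (countKey m lo hi k i).map σ.reg =
        [.num 0, .num i, σ.reg (lo i), σ.reg (hi i)] := by simp [countKey, hhi, c0, ci]
    unfold count
    rw [hval, hm]
    have h2' := h2 (.num i) (σ.reg (lo i)) (σ.reg (hi i))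
    rw [hT] at h2'
    by_cases hin : (σ.reg (lo i), σ.reg (hi i)) ∈ R i
    · rw [h2'.1 hin]
      have hne : ((R i).filter fun p => p = (σ.reg (lo i), σ.reg (hi i))).Nonempty :=
        ⟨_, Finset.mem_filter.2 ⟨hin, rfl⟩⟩
      exact ⟨rfl, by simpa [Word.toNat] using hne, hne.card_pos, fun h => by omega⟩
    · rw [h2'.2 hin]
      refine ⟨rfl, ?_, Nat.zero_le _, fun h => by omega⟩
      simp only [Word.toNat, ne_eq, not_true_eq_false, false_iff, Finset.not_nonempty_iff_eq_empty]
      refine Finset.filter_eq_empty_iff.2 ?_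
      rintro p hp rfl
      exact hin hp
  by_cases hlo : lo i < k
  · have hm : matching lo hi R k σ.reg i = (R i).filter fun p => p.1 = σ.reg (lo i) := by
      refine Finset.filter_congr fun p _ => ?_
      simp [hlo, hhi]
    obtain ⟨L, hL, hn, hmem⟩ := h1 (.num i) (σ.reg (lo i))
    have hval : (countKey m lo hi k i).map σ.reg = [.num 0, .num i, σ.reg (lo i)] := by
      simp [countKey, hhi, hlo, c0, ci]
    have hcount : count m lo hi k σ i = L.length := by rw [count, hval, hL.1]; rfl
    have hsub : L.toFinset = (matching lo hi R k σ.reg i).image Prod.snd := by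
      ext y
      simp [hm, hmem, hT]
    have hcard : L.length ≤ (matching lo hi R k σ.reg i).card := by
      rw [← List.toFinset_card_of_nodup hn, hsub]
      exact Finset.card_image_le
    rw [hcount]
    refine ⟨by rw [hval, hL.1], ?_, hcard, fun _ => ⟨L, hn, rfl, fun p hp => ⟨fun h => by omega,
      fun _ => ?_⟩, fun j hj g hg hgk => ?_⟩⟩
    · rw [← Finset.image_nonempty (f := Prod.snd), ← hsub, List.toFinset_nonempty_iff, ne_eq, ne_eq,
        List.length_eq_zero_iff]
    · rw [← List.mem_toFinset, hsub]
      exact Finset.mem_image_of_mem _ hp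
    · have := hL.2 j hj
      simpa [childKey, hlo, hg _ (.inl hlo), hgk, hg (m + n + 1) (by omega),
        hg (m + n + i) (by omega), c1, ci] using this
  · have hm : matching lo hi R k σ.reg i = R i := by
      refine Finset.filter_true_of_mem fun p _ => ?_
      simp [hlo, hhi]
    obtain ⟨L, hL, hn, hmem⟩ := h0 (.num i)
    have hval : (countKey m lo hi k i).map σ.reg = [.num 0, .num i] := by
      simp [countKey, hhi, hlo, c0, ci]
    have hcount : count m lo hi k σ i = L.length := by rw [count, hval, hL.1]; rfl
    have hsub : L.toFinset = (matching lo hi R k σ.reg i).image Prod.fst := by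
      ext y
      simp [hm, hmem, hT]
    have hcard : L.length ≤ (matching lo hi R k σ.reg i).card := by
      rw [← List.toFinset_card_of_nodup hn, hsub]
      exact Finset.card_image_le
    rw [hcount]
    refine ⟨by rw [hval, hL.1], ?_, hcard, fun _ => ⟨L, hn, rfl, fun p hp => ⟨fun _ => ?_,
      fun h => by omega⟩, fun j hj g hg hgk => ?_⟩⟩
    · rw [← Finset.image_nonempty (f := Prod.fst), ← hsub, List.toFinset_nonempty_iff, ne_eq, ne_eq,
        List.length_eq_zero_iff]
    · rw [← List.mem_toFinset, hsub]
      exact Finset.mem_image_of_mem _ hp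
    · have := hL.2 j hj
      simpa [childKey, hlo, hgk, hg (m + n + 1) (by omega), hg (m + n + i) (by omega), c1, ci]
        using this

variable {m' : ℕ} (V : LocalView D n m')

/-- The loads write only registers from `m` to `m + n - 1`, on which no count depends. The clause on
`i ∉ l` shows in the induction that a count already loaded is not overwritten. -/
theorem exec_guardCounts (hlh : ∀ i, lo i < hi i) {k : ℕ} (hk : k ≤ m) (body : VertexProgram)
    (l : List (Fin n)) (σ : LocalState D n) (hσ : Ready m R σ) :
    ∃ τ : LocalState D n, Keeps m m σ τ ∧ τ.out = σ.out ∧ τ.steps ≤ σ.steps + 2 * l.length + 1 ∧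
      (∀ i ∉ l, τ.reg (m + i) = σ.reg (m + i)) ∧
      (((∃ i ∈ l, count m lo hi k σ i = 0) ∧
          (guardCounts m lo hi k body l).exec V σ = τ) ∨
        ((∀ i ∈ l, count m lo hi k σ i ≠ 0 ∧ τ.reg (m + i) = .num (count m lo hi k σ i)) ∧
          τ.steps ≤ σ.steps + 2 * l.length ∧
          (guardCounts m lo hi k body l).exec V σ = body.exec V τ)) := by
  induction l generalizing σ with
  | nil => exact ⟨σ, Keeps.refl _ _ _, rfl, by simp, fun _ _ => rfl, .inr (by simp [guardCounts])⟩
  | cons i l ih =>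
    obtain ⟨hc, -⟩ := hσ.count_spec hlh k i
    have c0 : σ.reg (m + n) = .num 0 := hσ.const 0 (by omega)
    set c := count m lo hi k σ i with hcdef
    set σ₁ : LocalState D n := ⟨Function.update σ.reg (m + i) (.num c), σ.mem, σ.sent, σ.out,
      σ.steps + 1 + 1⟩ with hσ₁
    have hkeep : Keeps m m σ σ₁ := ⟨rfl, rfl, fun r hr => by
      simp only [hσ₁]
      rw [Function.update_of_ne (by omega)]⟩
    have hex : (guardCounts m lo hi k body (i :: l)).exec V σ =
        if c = 0 then VertexProgram.skip.exec V σ₁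
        else (guardCounts m lo hi k body l).exec V σ₁ := by
      have hne : m + n ≠ m + i := by omega
      simp only [guardCounts, VertexProgram.exec, LocalState.set, LocalState.tick, hc,
        Function.update_self, Function.update_of_ne hne, c0, Word.num.injEq, hσ₁]
    by_cases h0 : c = 0
    · refine ⟨VertexProgram.skip.exec V σ₁, ⟨hkeep.mem, hkeep.sent, hkeep.reg⟩, rfl, ?_, ?_,
        .inl ⟨⟨i, by simp, h0⟩, by rw [hex, if_pos h0]⟩⟩
      · simp [VertexProgram.exec, LocalState.tick, hσ₁]
        omega
      · intro j hj
        simp only [VertexProgram.exec, LocalState.tick, hσ₁]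
        refine Function.update_of_ne ?_ _ _
        simp only [List.mem_cons, not_or] at hj
        simpa [Fin.ext_iff] using hj.1
    · rw [if_neg h0] at hex
      obtain ⟨τ, k1, k2, k3, k4, k5⟩ := ih σ₁ (hσ.of_keeps hkeep)
      have hcount : ∀ j, count m lo hi k σ₁ j = count m lo hi k σ j :=
        (hkeep.mono hk).count_eq hlh
      simp only [hcount] at k5
      refine ⟨τ, hkeep.trans k1, k2, ?_, fun j hj => ?_, ?_⟩
      · simp only [hσ₁] at k3
        simp only [List.length_cons]
        omega
      · simp only [List.mem_cons, not_or] at hj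
        rw [k4 j hj.2]
        simp only [hσ₁]
        refine Function.update_of_ne ?_ _ _
        simpa [Fin.ext_iff] using hj.1
      · rw [hex]
        rcases k5 with ⟨⟨j, hj, hj0⟩, h⟩ | ⟨hall, hst, h⟩
        · exact .inl ⟨⟨j, by simp [hj], hj0⟩, h⟩
        · refine .inr ⟨fun j hj => ?_, ?_, h⟩
          · by_cases hjl : j ∈ l
            · exact hall j hjl
            · obtain rfl : j = i := by simpa [hjl] using hj
              refine ⟨h0, ?_⟩
              rw [k4 j hjl]
              simp [hσ₁]
              rfl
          · simp only [hσ₁] at hst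
            simp only [List.length_cons]
            omega

/-- Register numbers are fixed in the program text, so the minimum is found by a decision tree in
that text; each run follows one path, with one test per element of `l`. -/
theorem exec_chooseLeast (f : Fin n → VertexProgram) (l : List (Fin n)) (best : Fin n)
    (σ : LocalState D n) :
    ∃ i ∈ best :: l, (chooseLeast m f best l).exec V σ =
        (f i).exec V { σ with steps := σ.steps + l.length } ∧
      ∀ j ∈ best :: l, (σ.reg (m + i)).toNat ≤ (σ.reg (m + j)).toNat := by
  induction l generalizing best σ with
  | nil => exact ⟨best, by simp, rfl, by simp⟩
  | cons j l ih =>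
    have hstep : ∀ b, (({ σ.tick with steps := σ.tick.steps + l.length } : LocalState D n)) =
        { σ with steps := σ.steps + (b :: l).length } := by
      intro b
      simp only [LocalState.tick, List.length_cons]
      congr 1
      omega
    by_cases hle : (σ.reg (m + best)).toNat ≤ (σ.reg (m + j)).toNat
    · obtain ⟨i, hi, hex, hmin⟩ := ih best σ.tick
      refine ⟨i, ?_, ?_, fun a ha => ?_⟩
      · simp only [List.mem_cons] at hi ⊢
        tauto
      · rw [chooseLeast, VertexProgram.exec, if_pos hle, hex, hstep j]
      · simp only [List.mem_cons] at ha
        rcases ha with rfl | rfl | ha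
        · exact hmin a (by simp)
        · exact (hmin best (by simp)).trans hle
        · exact hmin a (by simp [ha])
    · obtain ⟨i, hi, hex, hmin⟩ := ih j σ.tick
      refine ⟨i, ?_, ?_, fun a ha => ?_⟩
      · simp only [List.mem_cons] at hi ⊢
        tauto
      · rw [chooseLeast, VertexProgram.exec, if_neg hle, hex, hstep j]
      · simp only [List.mem_cons] at ha
        rcases ha with rfl | ha
        · exact (hmin j (by simp)).trans (by simp only [LocalState.tick]; omega)
        · exact hmin a (by simpa using ha)

theorem IsExtension.matching_nonempty {k : ℕ} {t : ℕ → Word D n} {l : List (Word D n)}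
    (h : IsExtension m lo hi R k t l) (i : Fin n) : (matching lo hi R k t i).Nonempty := by
  obtain ⟨s, h1, h2, -⟩ := h
  exact ⟨_, Finset.mem_filter.2 ⟨h2 i, fun h => h1 _ h, fun h => h1 _ h⟩⟩

/-- The state `τ` results from `σ` by outputting the extensions of the values below `k`. -/
def Extends (m : ℕ) (lo hi : Fin n → ℕ) (R : Fin n → Finset (Word D n × Word D n)) (e : Fin n → ℝ)
    (C k : ℕ) (σ τ : LocalState D n) : Prop :=
  Keeps m k σ τ ∧ ∃ L, τ.out = σ.out ++ L ∧ (∀ l, l ∈ L ↔ IsExtension m lo hi R k σ.reg l) ∧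
    (L.length : ℝ) ≤ weight lo hi R e k σ.reg ∧
    (τ.steps : ℝ) ≤ σ.steps + C * (1 + weight lo hi R e k σ.reg)

/-- Register `k` first holds the loop index and is then overwritten by the candidate; the loop sets
it afresh each time. The summand 2 counts the iteration and the load. -/
theorem exec_candidates {e : Fin n → ℝ} {k C : ℕ} (hk : k < m) (body : VertexProgram)
    (hbody : ∀ σ : LocalState D n, Ready m R σ →
      Extends m lo hi R e C (k + 1) σ (body.exec V σ))
    (σ : LocalState D n) (hσ : Ready m R σ) (i : Fin n) (L : List (Word D n))
    (hL : ∀ j (hj : j < L.length) (g : ℕ → Word D n), (∀ r, r < k ∨ m + n ≤ r → g r = σ.reg r) →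
        g k = .num j → σ.mem ((childKey m lo k i).map g) = L[j])
    (c : ℕ) (hc : c ≤ L.length) :
    ∃ τ, (List.range c).foldl (fun τ j => (VertexProgram.seq (.load k (childKey m lo k i))
        body).exec V (τ.set k (.num j)).tick) σ = τ ∧ Keeps m k σ τ ∧
      ∃ O, τ.out = σ.out ++ O ∧
        (∀ l, l ∈ O ↔ ∃ d ∈ L.take c,
          IsExtension m lo hi R (k + 1) (Function.update σ.reg k d) l) ∧
        (O.length : ℝ) ≤ ((L.take c).map fun d =>
          weight lo hi R e (k + 1) (Function.update σ.reg k d)).sum ∧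
        (τ.steps : ℝ) ≤ σ.steps + ((L.take c).map fun d =>
          (2 + C * (1 + weight lo hi R e (k + 1) (Function.update σ.reg k d)) : ℝ)).sum := by
  induction c with
  | zero => exact ⟨σ, rfl, Keeps.refl _ _ _, [], by simp⟩
  | succ c ih =>
    obtain ⟨τ, h1, h2, O, h3, h4, h5, h6⟩ := ih (by omega)
    rw [List.range_succ, List.foldl_append, h1, List.foldl_cons, List.foldl_nil]
    set ρ : LocalState D n := ⟨Function.update τ.reg k L[c], τ.mem, τ.sent, τ.out, τ.steps + 2⟩
      with hρ
    have hload : τ.mem ((childKey m lo k i).map (Function.update τ.reg k (.num c))) = L[c] := by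
      rw [h2.mem]
      refine hL c _ _ (fun r hr => ?_) (by simp)
      rw [Function.update_of_ne (by omega), h2.reg r hr]
    have hex : (VertexProgram.seq (.load k (childKey m lo k i)) body).exec V
        (τ.set k (.num c)).tick = body.exec V ρ := by
      simp only [VertexProgram.exec, LocalState.set, LocalState.tick, hload,
        Function.update_idem, hρ]
    have hkeep : Keeps m k τ ρ := ⟨rfl, rfl, fun r hr => by
      simp only [hρ]
      rw [Function.update_of_ne (by omega)]⟩
    have hagree : ∀ a < k + 1, ρ.reg a = Function.update σ.reg k L[c] a := by
      intro a ha
      rcases (Nat.lt_succ_iff.1 ha).eq_or_lt with rfl | hlt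
      · simp [hρ]
      · simp only [hρ]
        rw [Function.update_of_ne hlt.ne, Function.update_of_ne hlt.ne, h2.reg a (.inl hlt)]
    obtain ⟨b1, O', b2, b3, b4, b5⟩ := hbody ρ ((hσ.of_keeps h2).of_keeps hkeep)
    rw [weight_congr hagree] at b4 b5
    have htake : L.take (c + 1) = L.take c ++ [L[c]] := by simp
    refine ⟨_, rfl, ?_, O ++ O', ?_, fun l => ?_, ?_, ?_⟩
    · rw [hex]
      exact h2.trans (hkeep.trans (b1.mono (Nat.le_succ k)))
    · rw [hex, b2, ← List.append_assoc, ← h3]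
    · rw [htake, List.mem_append, h4, b3, isExtension_congr hagree]
      simp only [List.mem_append, List.mem_singleton, or_and_right, exists_or, exists_eq_left]
    · rw [htake]
      simp only [List.length_append, List.map_append, List.sum_append, List.map_cons, List.map_nil,
        List.sum_singleton]
      push_cast
      linarith
    · rw [htake, hex]
      simp only [List.map_append, List.sum_append, List.map_cons, List.map_nil,
        List.sum_singleton]
      have : (ρ.steps : ℝ) = τ.steps + 2 := by simp [hρ]
      linarith

/-- A dead end loses no result, and its steps are paid by the summand 1 next to the weight. -/
theorem Extends.of_out_eq {e : Fin n → ℝ} {k C : ℕ} {σ τ : LocalState D n} (hk : Keeps m k σ τ)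
    (hout : τ.out = σ.out) (hex : ∃ i, ¬ (matching lo hi R k σ.reg i).Nonempty)
    (hsteps : τ.steps ≤ σ.steps + C) : Extends m lo hi R e C k σ τ := by
  obtain ⟨i, hni⟩ := hex
  refine ⟨hk, [], by simp [hout], fun l => ?_, by simpa using weight_nonneg, ?_⟩
  · simp only [List.not_mem_nil, false_iff]
    exact fun h => hni (h.matching_nonempty i)
  · have h1 : (τ.steps : ℝ) ≤ σ.steps + C := by exact_mod_cast hsteps
    have h2 : (0 : ℝ) ≤ C * weight lo hi R e k σ.reg := mul_nonneg (Nat.cast_nonneg _) weight_nonneg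
    linarith

/-- With all attributes bound, nonzero counts say that the values form a join result; the weight is
then at least 1 and pays for it. -/
theorem exec_extendAll_zero (hlh : ∀ i, lo i < hi i) (hm : ∀ i, hi i < m) {e : Fin n → ℝ}
    (he : ∀ i, 0 ≤ e i) (σ : LocalState D n) (hσ : Ready m R σ) :
    Extends m lo hi R e (extendCost n 0) m σ ((extendAll m lo hi 0 m).exec V σ) := by
  obtain ⟨τ, k1, k2, k3, -, k5⟩ := exec_guardCounts V hlh le_rfl (.emit (List.range m))
    (List.finRange n) σ hσ
  rw [List.length_finRange] at k3
  rcases k5 with ⟨⟨i, -, hi0⟩, hex⟩ | ⟨hall, hst, hex⟩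
  · rw [extendAll, hex]
    refine Extends.of_out_eq k1 k2 ⟨i, fun h => ?_⟩ (by simp only [extendCost]; omega)
    exact ((hσ.count_spec hlh m i).2.1.2 h) hi0
  · rw [extendAll, hex]
    have hne : ∀ i, (matching lo hi R m σ.reg i).Nonempty := fun i =>
      (hσ.count_spec hlh m i).2.1.1 (hall i (List.mem_finRange i)).1
    have hw := one_le_weight (e := e) he hne
    have hmap : (List.range m).map τ.reg = (List.range m).map σ.reg :=
      List.map_congr_left fun r hr => k1.reg r (.inl (List.mem_range.1 hr))
    refine ⟨⟨k1.mem, k1.sent, k1.reg⟩, [(List.range m).map σ.reg], ?_, fun l => ?_, ?_, ?_⟩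
    · simp only [VertexProgram.exec, LocalState.tick, k2, hmap]
    · rw [List.mem_singleton]
      constructor
      · rintro rfl
        refine ⟨σ.reg, fun _ _ => rfl, fun i => ?_, rfl⟩
        obtain ⟨p, hp⟩ := hne i
        obtain ⟨hp, h1, h2⟩ := Finset.mem_filter.1 hp
        rw [← h1 ((hlh i).trans (hm i)), ← h2 (hm i)]
        exact hp
      · rintro ⟨s, h1, -, rfl⟩
        exact List.map_congr_left fun r hr => h1 r (List.mem_range.1 hr)
    · simpa using hw
    · rw [List.length_finRange] at hst
      have hs : (((VertexProgram.emit (List.range m)).exec V τ).steps : ℝ) ≤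
          σ.steps + extendCost n 0 := by
        have : ((VertexProgram.emit (List.range m)).exec V τ).steps ≤
            σ.steps + extendCost n 0 := by
          simp only [VertexProgram.exec, LocalState.tick, extendCost]
          omega
        exact_mod_cast this
      have h2 : (0 : ℝ) ≤ extendCost n 0 * weight lo hi R e m σ.reg :=
        mul_nonneg (Nat.cast_nonneg _) weight_nonneg
      linarith

theorem exec_extendAll_succ (hlh : ∀ i, lo i < hi i) {e : Fin n → ℝ} (he : ∀ i, 0 ≤ e i)
    {k r : ℕ} (hk : k < m)
    (hcov : 1 ≤ ∑ i ∈ Finset.univ.filter (fun i => lo i = k ∨ hi i = k), e i)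
    (ih : ∀ σ : LocalState D n, Ready m R σ →
      Extends m lo hi R e (extendCost n r) (k + 1) σ ((extendAll m lo hi r (k + 1)).exec V σ))
    (σ : LocalState D n) (hσ : Ready m R σ) :
    Extends m lo hi R e (extendCost n (r + 1)) k σ ((extendAll m lo hi (r + 1) k).exec V σ) := by
  have hcont : ∀ i, i ∈ containing lo hi k ↔ lo i = k ∨ hi i = k := by simp [containing]
  have hclen : (containing lo hi k).length ≤ n := by
    simpa only [containing, List.length_finRange] using
      List.length_filter_le (fun i => decide (lo i = k ∨ hi i = k)) (List.finRange n)
  rw [extendAll]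
  cases hI : containing lo hi k with
  | nil =>
    -- An attribute in no relation would be covered by weight 0.
    rw [Finset.filter_eq_empty_iff.2 (fun i _ h => by simpa [hI] using (hcont i).2 h)] at hcov
    norm_num at hcov
  | cons i₀ l =>
    rw [hI] at hclen
    simp only [List.length_cons] at hclen
    obtain ⟨τ, k1, k2, k3, -, k5⟩ := exec_guardCounts V hlh hk.le
      (chooseLeast m (tryCandidates m lo k (extendAll m lo hi r (k + 1))) i₀ l)
      (List.finRange n) σ hσ
    have k1' := k1.mono hk.le
    rw [List.length_finRange] at k3
    rcases k5 with ⟨⟨i, -, hi0⟩, hex⟩ | ⟨hall, hst, hex⟩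
    · rw [hex]
      refine Extends.of_out_eq k1' k2 ⟨i, fun h => ?_⟩ (by simp only [extendCost]; omega)
      exact ((hσ.count_spec hlh k i).2.1.2 h) hi0
    rw [hex]
    rw [List.length_finRange] at hst
    have hne : ∀ i, (matching lo hi R k σ.reg i).Nonempty := fun i =>
      (hσ.count_spec hlh k i).2.1.1 (hall i (List.mem_finRange i)).1
    obtain ⟨i, hik, hex', hmin⟩ := exec_chooseLeast (m := m) V
      (tryCandidates m lo k (extendAll m lo hi r (k + 1))) l i₀ τ
    rw [hex']
    rw [← hI, hcont] at hik
    obtain ⟨-, -, -, hcand⟩ := hσ.count_spec (lo := lo) (hi := hi) hlh k i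
    obtain ⟨L, hLn, hLlen, hLmem, hLget⟩ := hcand hik
    have hreg : ∀ j : Fin n, τ.reg (m + j) = .num (count m lo hi k σ j) := fun j =>
      (hall j (List.mem_finRange j)).2
    -- The chosen count is the least one, so it is at most the number of matching tuples in every
    -- relation containing `k`.
    have hLw : (L.length : ℝ) ≤ weight lo hi R e k σ.reg := by
      refine natCast_le_weight he hcov hne _ fun j hj => ?_
      rw [← hcont, hI] at hj
      have := hmin j hj
      rw [hreg, hreg] at this
      rw [hLlen]
      exact this.trans (hσ.count_spec hlh k j).2.2.1
    set τ₁ : LocalState D n := { τ with steps := τ.steps + l.length + 1 } with hτ₁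
    have hkeep₁ : Keeps m k σ τ₁ := ⟨k1'.mem, k1'.sent, k1'.reg⟩
    obtain ⟨ρ, hρ, hρk, O, h3, h4, h5, h6⟩ := exec_candidates V hk (extendAll m lo hi r (k + 1)) ih
      τ₁ (hσ.of_keeps hkeep₁) i L (fun j hj g hg hgk => by
        rw [hkeep₁.mem]
        exact hLget j hj g (fun a ha => (hg a ha).trans (hkeep₁.reg a ha)) hgk) L.length le_rfl
    have hexρ : (tryCandidates m lo k (extendAll m lo hi r (k + 1)) i).exec V
        { τ with steps := τ.steps + l.length } = ρ := by
      rw [← hρ, tryCandidates, VertexProgram.exec]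
      simp only [hreg, Word.toNat, hLlen]
      rfl
    rw [hexρ]
    rw [List.take_length] at h4 h5 h6
    have hagree : ∀ d, ∀ a < k + 1, Function.update τ₁.reg k d a = Function.update σ.reg k d a := by
      intro d a ha
      rcases (Nat.lt_succ_iff.1 ha).eq_or_lt with rfl | hlt
      · simp
      · rw [Function.update_of_ne hlt.ne, Function.update_of_ne hlt.ne, hkeep₁.reg a (.inl hlt)]
    simp only [fun d => weight_congr (lo := lo) (hi := hi) (R := R) (e := e) (hagree d)] at h5 h6
    have hsum : (L.map fun d => weight lo hi R e (k + 1) (Function.update σ.reg k d)).sum ≤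
        weight lo hi R e k σ.reg := by
      rw [← List.sum_toFinset _ hLn]
      exact sum_weight_update_le he hcov hne _
    refine ⟨hkeep₁.trans hρk, O, by rw [h3, ← k2], fun s => ?_, h5.trans hsum, ?_⟩
    · rw [h4]
      constructor
      · rintro ⟨d, -, hd⟩
        rw [isExtension_congr (hagree d)] at hd
        obtain ⟨s, g1, g2, g3⟩ := hd
        refine ⟨s, fun a ha => ?_, g2, g3⟩
        rw [g1 a (by omega), Function.update_of_ne ha.ne]
      · rintro ⟨s, g1, g2, g3⟩
        have hp : (s (lo i), s (hi i)) ∈ matching lo hi R k σ.reg i :=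
          Finset.mem_filter.2 ⟨g2 i, fun h => g1 _ h, fun h => g1 _ h⟩
        -- The chosen relation contains `k` and a tuple of it agrees with `s`, so `s k` is among its
        -- candidates.
        refine ⟨s k, ?_, ?_⟩
        · rcases hik with rfl | rfl
          exacts [(hLmem _ hp).1 rfl, (hLmem _ hp).2 rfl]
        · rw [isExtension_congr (hagree (s k))]
          refine ⟨s, fun a ha => ?_, g2, g3⟩
          rcases (Nat.lt_succ_iff.1 ha).eq_or_lt with rfl | hlt
          · simp
          · rw [Function.update_of_ne hlt.ne, g1 a hlt]
    · have hsplit : (L.map fun d => (2 + (extendCost n r : ℝ) *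
          (1 + weight lo hi R e (k + 1) (Function.update σ.reg k d)) : ℝ)).sum =
          L.length * (2 + extendCost n r) + extendCost n r *
            (L.map fun d => weight lo hi R e (k + 1) (Function.update σ.reg k d)).sum := by
        clear hLn hLlen hLmem hLget hLw h4 h5 h6 hsum hρ
        induction L with
        | nil => simp
        | cons d L ihL =>
          simp only [List.map_cons, List.sum_cons, ihL, List.length_cons]
          push_cast
          ring
      rw [hsplit] at h6
      have hst₁ : (τ₁.steps : ℝ) ≤ σ.steps + 3 * n + 1 := by
        have : τ₁.steps ≤ σ.steps + 3 * n + 1 := by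
          simp only [hτ₁]
          omega
        exact_mod_cast this
      have hC : (0 : ℝ) ≤ extendCost n r := Nat.cast_nonneg _
      have hw := weight_nonneg (lo := lo) (hi := hi) (R := R) (e := e) (k := k) (t := σ.reg)
      have e1 := mul_le_mul_of_nonneg_right hLw (by linarith : (0 : ℝ) ≤ 2 + extendCost n r)
      have e2 := mul_le_mul_of_nonneg_left hsum hC
      have hn : (0 : ℝ) ≤ n * weight lo hi R e k σ.reg := mul_nonneg (Nat.cast_nonneg _) hw
      -- At most `3 * n + 1` steps precede the loop. With `C = extendCost n r` and `w` the weight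
      -- here, the candidates cost at most `w * (2 + C) + C * w`: their number and the sum of their
      -- weights are both at most `w`.
      rw [extendCost]
      push_cast
      nlinarith

theorem exec_extendAll (hlh : ∀ i, lo i < hi i) (hm : ∀ i, hi i < m) {e : Fin n → ℝ}
    (he : ∀ i, 0 ≤ e i)
    (hcov : ∀ k < m, 1 ≤ ∑ i ∈ Finset.univ.filter (fun i => lo i = k ∨ hi i = k), e i)
    (r k : ℕ) (hrk : k + r = m) (σ : LocalState D n) (hσ : Ready m R σ) :
    Extends m lo hi R e (extendCost n r) k σ ((extendAll m lo hi r k).exec V σ) := by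
  induction r generalizing k σ with
  | zero =>
    obtain rfl : k = m := by omega
    exact exec_extendAll_zero V hlh hm he σ hσ
  | succ r ih =>
    exact exec_extendAll_succ V hlh he (by omega) (hcov k (by omega))
      (fun σ hσ => ih (k + 1) (by omega) σ hσ) σ hσ

end Extend

/-! ### The vertex program -/

/-- Store the numbers below `c` in the registers from `b` on. -/
def setConstants (b : ℕ) : ℕ → VertexProgram
  | 0 => .skip
  | j + 1 => .seq (setConstants b j) (.const (b + j) j)

/-- Send the row in registers `1` and `2` to the vertex in register `3`, with its columns swapped if
the label in register `0` belongs to one of the given relations. -/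
def sendOriented {n : ℕ} : List (Fin n) → VertexProgram
  | [] => .send 3 [0, 1, 2]
  | i :: l => .seq (.const 4 i) (.ifEq 0 4 (.send 3 [0, 2, 1]) (sendOriented l))

namespace BinaryQuery

variable {n m : ℕ} (q : BinaryQuery n m)

/-- The smaller attribute of a relation. -/
def lo (i : Fin n) : ℕ := min (q.left i : ℕ) (q.right i)

/-- The larger attribute of a relation. -/
def hi (i : Fin n) : ℕ := max (q.left i : ℕ) (q.right i)

theorem lo_lt_hi (i : Fin n) : q.lo i < q.hi i := by
  have := q.left_ne_right i
  rw [ne_eq, Fin.ext_iff] at this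
  unfold lo hi
  omega

theorem hi_lt (i : Fin n) : q.hi i < m := by
  have := (q.left i).2
  have := (q.right i).2
  unfold hi
  omega

theorem lo_eq_or_hi_eq (i : Fin n) (k : Fin m) :
    (q.lo i = k ∨ q.hi i = k) ↔ (q.left i = k ∨ q.right i = k) := by
  unfold lo hi
  simp only [Fin.ext_iff]
  omega

/-- Send the own label and row to the aggregation vertex, smaller attribute first. -/
def distribute : VertexProgram :=
  .seq (.label 0) <| .seq (.datum 1 0) <| .seq (.datum 2 1) <| .seq (.aggregatorId 3)
    (sendOriented ((List.finRange n).filter fun i => q.right i < q.left i))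

/-- Store the received rows in tries and output the join. -/
def localJoin : VertexProgram :=
  .seq (setConstants (m + n) (n + 2)) <|
    .seq (loadInbox (m + n) (m + n + 1) (m + n + n + 2)) (extendAll m q.lo q.hi m 0)

/-- In the first superstep all vertices send their rows to the aggregation vertex, which outputs
the join in the second superstep. -/
def joinProgram : VertexProgram :=
  .seq (.superstep 0) <| .seq (.const 1 0) (.ifEq 0 1 q.distribute q.localJoin)

/-! ### Rows as messages, oriented by the order of the attributes -/

variable {D : Type u}

/-- A row with the smaller attribute first. -/
def orient (i : Fin n) (p : D × D) : Word D n × Word D n :=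
  if q.right i < q.left i then (.val p.2, .val p.1) else (.val p.1, .val p.2)

theorem orient_injective (i : Fin n) : Function.Injective (q.orient i (D := D)) := by
  intro p p' h
  unfold orient at h
  split_ifs at h <;> simpa [Prod.ext_iff, and_comm] using h

/-- The row that a vertex sends to the aggregation vertex. -/
def sentRow : Vertex D n → Word D n × Word D n × Word D n
  | .tuple i x y => (.num i, q.orient i (x, y))
  | .value d => (.num n, .val d, .num 0)
  | .aggregator => (.num (n + 1), .num 0, .num 0)

/-- This makes the inbox of the aggregation vertex duplicate-free, as trie insertion requires. Value
vertices and the aggregation vertex also send a row, under the labels `n` and `n + 1`, which name no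
relation. -/
theorem sentRow_injective : Function.Injective (q.sentRow (D := D)) := by
  rintro (⟨i, x, y⟩ | d | _) (⟨j, x', y'⟩ | d' | _) h <;>
    simp only [sentRow, Prod.mk.injEq, Word.num.injEq, Word.val.injEq] at h
  · obtain ⟨h1, h2⟩ := h
    obtain rfl := Fin.ext h1
    have := q.orient_injective i h2
    simp only [Prod.mk.injEq] at this
    rw [this.1, this.2]
  all_goals first | rfl | (simp_all; done) | (exfalso; omega)

variable [DecidableEq D] (db : Database D n)

/-- The relations with the smaller attribute first. -/
def orientedRows (i : Fin n) : Finset (Word D n × Word D n) := ((db.rows i).map (q.orient i)).toFinset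

theorem card_orientedRows (i : Fin n) : (q.orientedRows db i).card = db.card i := by
  rw [orientedRows, List.toFinset_card_of_nodup ((db.nodup i).map (q.orient_injective i)),
    List.length_map, Database.card]

theorem mem_orientedRows (i : Fin n) (s : ℕ → Word D n) :
    (s (q.lo i), s (q.hi i)) ∈ q.orientedRows db i ↔
      ∃ p ∈ db.rows i, s (q.left i) = .val p.1 ∧ s (q.right i) = .val p.2 := by
  simp only [orientedRows, List.mem_toFinset, List.mem_map]
  refine exists_congr fun p => and_congr_right fun _ => ?_
  by_cases h : q.right i < q.left i
  · have h' : (q.right i : ℕ) < q.left i := h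
    have h1 : q.lo i = q.right i := by unfold lo; omega
    have h2 : q.hi i = q.left i := by unfold hi; omega
    rw [orient, if_pos h, h1, h2, Prod.mk.injEq]
    constructor
    · rintro ⟨h, h'⟩
      exact ⟨h'.symm, h.symm⟩
    · rintro ⟨h, h'⟩
      exact ⟨h'.symm, h.symm⟩
  · have h' : ¬ (q.right i : ℕ) < q.left i := h
    have h1 : q.lo i = q.left i := by unfold lo; omega
    have h2 : q.hi i = q.right i := by unfold hi; omega
    rw [orient, if_neg h, h1, h2, Prod.mk.injEq]
    constructor
    · rintro ⟨h, h'⟩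
      exact ⟨h.symm, h'.symm⟩
    · rintro ⟨h, h'⟩
      exact ⟨h.symm, h'.symm⟩

theorem IsFractionalEdgeCover.exists_mem {q : BinaryQuery n m} {e : Fin n → ℝ}
    (h : q.IsFractionalEdgeCover e) (a : Fin m) : ∃ i, q.left i = a ∨ q.right i = a := by
  by_contra! hno
  have := h.2 a
  rw [Finset.filter_eq_empty_iff.2 (fun i _ hi => hi.elim (hno i).1 (hno i).2)] at this
  norm_num at this

theorem IsFractionalEdgeCover.one_le_sum {q : BinaryQuery n m} {e : Fin n → ℝ}
    (h : q.IsFractionalEdgeCover e) (k : ℕ) (hk : k < m) :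
    1 ≤ ∑ i ∈ Finset.univ.filter (fun i => q.lo i = k ∨ q.hi i = k), e i := by
  simpa only [← q.lo_eq_or_hi_eq _ ⟨k, hk⟩] using h.2 ⟨k, hk⟩

/-- The cover puts every attribute into some relation, which forces the words of an extension to be
data values. -/
theorem isExtension_zero_iff {e : Fin n → ℝ} (h : q.IsFractionalEdgeCover e) (t : ℕ → Word D n)
    (l : List (Word D n)) :
    IsExtension m q.lo q.hi (q.orientedRows db) 0 t l ↔
      ∃ f ∈ q.join db, (List.ofFn fun a => Word.val (f a)) = l := by
  constructor
  · rintro ⟨s, -, hs, rfl⟩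
    have hval : ∀ a : Fin m, ∃ d, s a = .val d := by
      intro a
      obtain ⟨i, hi⟩ := h.exists_mem a
      obtain ⟨p, -, h1, h2⟩ := (q.mem_orientedRows db i s).1 (hs i)
      rcases hi with rfl | rfl
      exacts [⟨_, h1⟩, ⟨_, h2⟩]
    choose f hf using hval
    refine ⟨f, fun i => ?_, ?_⟩
    · obtain ⟨p, hp, h1, h2⟩ := (q.mem_orientedRows db i s).1 (hs i)
      rw [hf, Word.val.injEq] at h1 h2
      rw [h1, h2]
      exact hp
    · simp only [← hf]
      exact List.ext_getElem (by simp) (by simp)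
  · rintro ⟨f, hf, rfl⟩
    refine ⟨fun a => if ha : a < m then .val (f ⟨a, ha⟩) else .num 0, fun a ha => by omega,
      fun i => ?_, ?_⟩
    · exact (q.mem_orientedRows db i fun a => if ha : a < m then .val (f ⟨a, ha⟩) else .num 0).2
        ⟨_, hf i, by simp, by simp⟩
    · refine List.ext_getElem (by simp) fun j hj hj' => ?_
      have : j < m := by simpa using hj
      simp [this]

end BinaryQuery

/-! ### Correctness and cost -/

namespace Database

variable {D : Type u} [DecidableEq D] {n m : ℕ} (db : Database D n)

theorem nodup_vertices : db.vertices.Nodup := by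
  unfold vertices
  refine List.nodup_append.2 ⟨List.nodup_append.2 ⟨?_, ?_, ?_⟩, List.nodup_singleton _, ?_⟩
  · refine List.nodup_flatMap.2 ⟨fun i _ => ?_, ?_⟩
    · refine (db.nodup i).map fun p p' h => ?_
      simpa [Prod.ext_iff] using h
    · refine (List.nodup_finRange n).imp fun {i j} hij => ?_
      simp only [Function.onFun, List.disjoint_left, List.mem_map]
      rintro _ ⟨p, -, rfl⟩ ⟨p', -, h⟩
      simp only [Vertex.tuple.injEq] at h
      exact hij h.1.symm
  · exact (List.nodup_dedup _).map fun d d' h => by simpa using h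
  · intro v hv w hw
    simp only [List.mem_flatMap, List.mem_map] at hv hw
    obtain ⟨i, -, p, -, rfl⟩ := hv
    obtain ⟨d, -, rfl⟩ := hw
    simp
  · intro v hv w hw
    rw [List.mem_singleton.1 hw]
    rintro rfl
    simp at hv

/-- Each row accounts for one tuple vertex and at most two values. -/
theorem length_vertices_le : db.vertices.length ≤ 3 * db.inputSize + 1 := by
  have h1 : ((List.finRange n).flatMap fun i => (db.rows i).map fun p =>
      (Vertex.tuple i p.1 p.2 : Vertex D n)).length = db.inputSize := by
    simp [List.length_flatMap, inputSize, card, ← List.ofFn_eq_map, List.sum_ofFn]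
  have h2 : db.activeDomain.length ≤ 2 * db.inputSize := by
    refine (List.dedup_sublist _).length_le.trans ?_
    simp [List.length_flatMap, inputSize, card, ← List.ofFn_eq_map, List.sum_ofFn, Finset.mul_sum,
      mul_comm]
  unfold vertices
  simp only [List.length_append, h1, List.length_map, List.length_singleton]
  omega

theorem mem_sentRows_iff (q : BinaryQuery n m) (i : Fin n) (x y : Word D n) :
    (Word.num i, x, y) ∈ db.vertices.map q.sentRow ↔ (x, y) ∈ q.orientedRows db i := by
  simp only [List.mem_map, BinaryQuery.orientedRows, List.mem_toFinset]
  constructor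
  · rintro ⟨v, hv, h⟩
    rcases v with ⟨j, a, b⟩ | d | _ <;>
      simp only [BinaryQuery.sentRow, Prod.mk.injEq, Word.num.injEq] at h
    · obtain ⟨h1, h2⟩ := h
      obtain rfl := Fin.ext h1
      refine ⟨(a, b), ?_, h2⟩
      simpa [vertices] using hv
    · omega
    · omega
  · rintro ⟨p, hp, h⟩
    refine ⟨.tuple i p.1 p.2, ?_, ?_⟩
    · simpa [vertices] using hp
    · rw [BinaryQuery.sentRow, h]

end Database

/-! ### The local program in each of the two supersteps -/

section Exec

variable {D : Type u} [DecidableEq D] {n m : ℕ} (V : LocalView D n m)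

theorem exec_setConstants (b c : ℕ) (σ : LocalState D n) :
    ((setConstants b c).exec V σ).mem = σ.mem ∧ ((setConstants b c).exec V σ).sent = σ.sent ∧
    ((setConstants b c).exec V σ).out = σ.out ∧
    ((setConstants b c).exec V σ).steps = σ.steps + c + 1 ∧
    ∀ j < c, ((setConstants b c).exec V σ).reg (b + j) = .num j := by
  induction c with
  | zero => simp [setConstants, VertexProgram.exec, LocalState.tick]
  | succ c ih =>
    obtain ⟨h1, h2, h3, h4, h5⟩ := ih
    refine ⟨h1, h2, h3, ?_, fun j hj => ?_⟩
    · simp only [setConstants, VertexProgram.exec, LocalState.tick, LocalState.set, h4]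
      omega
    · simp only [setConstants, VertexProgram.exec, LocalState.tick, LocalState.set]
      rcases (Nat.lt_succ_iff.1 hj).eq_or_lt with rfl | hlt
      · simp
      · rw [Function.update_of_ne (by omega), h5 j hlt]

theorem exec_sendOriented (l : List (Fin n)) (σ : LocalState D n)
    (h3 : σ.reg 3 = .id .aggregator) :
    ((sendOriented l).exec V σ).mem = σ.mem ∧
    ((sendOriented l).exec V σ).out = σ.out ∧
    ((sendOriented l).exec V σ).steps ≤ σ.steps + 2 * l.length + 1 ∧
    ((∃ i ∈ l, σ.reg 0 = .num i) → ((sendOriented l).exec V σ).sent =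
      σ.sent ++ [(.aggregator, [σ.reg 0, σ.reg 2, σ.reg 1])]) ∧
    ((¬ ∃ i ∈ l, σ.reg 0 = .num i) → ((sendOriented l).exec V σ).sent =
      σ.sent ++ [(.aggregator, [σ.reg 0, σ.reg 1, σ.reg 2])]) := by
  induction l generalizing σ with
  | nil => simp [sendOriented, VertexProgram.exec, LocalState.tick, LocalState.post, h3]
  | cons i l ih =>
    by_cases hi : σ.reg 0 = .num i
    · simp [sendOriented, VertexProgram.exec, LocalState.tick, LocalState.set, LocalState.post, h3,
        hi]
      omega
    · obtain ⟨g1, g2, g3, g4, g5⟩ := ih ((σ.set 4 (.num i)).tick.tick)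
        (by simpa [LocalState.tick, LocalState.set] using h3)
      have hex : (sendOriented (i :: l)).exec V σ =
          (sendOriented l).exec V ((σ.set 4 (.num i)).tick.tick) := by
        simp [sendOriented, VertexProgram.exec, LocalState.tick, LocalState.set, hi]
      rw [hex]
      simp only [LocalState.tick, LocalState.set] at g1 g2 g3 g4 g5 ⊢
      refine ⟨g1, g2, ?_, ?_, ?_⟩
      · simp only [List.length_cons]
        omega
      · simpa [hi] using g4
      · simpa [hi] using g5

theorem exec_joinProgram_zero (q : BinaryQuery n m) (hV : V.time = 0)
    (M : List (Word D n) → Word D n) :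
    (q.joinProgram.exec V (LocalState.start M)).mem = M ∧
    (q.joinProgram.exec V (LocalState.start M)).out = [] ∧
    (q.joinProgram.exec V (LocalState.start M)).steps ≤ 2 * n + 8 ∧
    (q.joinProgram.exec V (LocalState.start M)).sent = [(.aggregator,
      [(q.sentRow V.self).1, (q.sentRow V.self).2.1, (q.sentRow V.self).2.2])] := by
  set l := (List.finRange n).filter fun i => q.right i < q.left i with hl
  have hlen : l.length ≤ n := by
    simpa only [List.length_finRange] using
      List.length_filter_le (fun i => decide (q.right i < q.left i)) (List.finRange n)
  -- The state after seven steps: the superstep test takes three, and four instructions prepare the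
  -- message.
  set σ : LocalState D n := ⟨Function.update (Function.update (Function.update (Function.update
    (Function.update (Function.update (fun _ => .num 0) 0 (.num 0)) 1 (.num 0))
    0 (.num V.label)) 1 (V.data.getD 0 (.num 0))) 2 (V.data.getD 1 (.num 0))) 3 (.id .aggregator),
    M, [], [], 7⟩ with hσ
  have hex : q.joinProgram.exec V (LocalState.start M) = (sendOriented l).exec V σ := by
    simp [BinaryQuery.joinProgram, BinaryQuery.distribute, VertexProgram.exec, LocalState.start,
      LocalState.set, LocalState.tick, hV, hσ, hl]
  have r0 : σ.reg 0 = .num V.label := by simp [hσ]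
  have r1 : σ.reg 1 = V.data.getD 0 (.num 0) := by simp [hσ]
  have r2 : σ.reg 2 = V.data.getD 1 (.num 0) := by simp [hσ]
  obtain ⟨g1, g2, g3, g4, g5⟩ := exec_sendOriented V l σ (by simp [hσ])
  rw [hex]
  refine ⟨g1, g2, g3.trans (by simp only [hσ]; omega), ?_⟩
  rw [r0, r1, r2] at g4 g5
  have hmem : (∃ i ∈ l, (Word.num V.label : Word D n) = .num i) ↔
      ∃ i : Fin n, q.right i < q.left i ∧ V.label = i := by simp [hl]
  rw [hmem] at g4 g5
  have hs : σ.sent = [] := rfl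
  rw [hs, List.nil_append] at g4 g5
  clear_value σ
  obtain ⟨time, v, edges, inbox⟩ := V
  rcases v with ⟨i, x, y⟩ | d | _
  · by_cases h : q.right i < q.left i
    · rw [g4 ⟨i, h, rfl⟩]
      simp [LocalView.label, LocalView.data, BinaryQuery.sentRow, BinaryQuery.orient, h]
    · rw [g5]
      · simp [LocalView.label, LocalView.data, BinaryQuery.sentRow, BinaryQuery.orient, h]
      · rintro ⟨j, hj, hij⟩
        obtain rfl : i = j := Fin.ext hij
        exact h hj
  · rw [g5]
    · simp [LocalView.label, LocalView.data, BinaryQuery.sentRow]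
    · rintro ⟨j, -, hj⟩
      simp only [LocalView.label] at hj
      omega
  · rw [g5]
    · simp [LocalView.label, LocalView.data, BinaryQuery.sentRow]
    · rintro ⟨j, -, hj⟩
      simp only [LocalView.label] at hj
      omega

theorem exec_joinProgram_one (q : BinaryQuery n m) {e : Fin n → ℝ}
    (hcover : q.IsFractionalEdgeCover e) (db : Database D n) (hV : V.time = 1)
    (hin : V.inbox = (db.vertices.map q.sentRow).map fun p => [p.1, p.2.1, p.2.2]) :
    (q.joinProgram.exec V (LocalState.start fun _ => .num 0)).sent = [] ∧
    (∀ l, l ∈ (q.joinProgram.exec V (LocalState.start fun _ => .num 0)).out ↔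
      ∃ f ∈ q.join db, (List.ofFn fun a => Word.val (f a)) = l) ∧
    ((q.joinProgram.exec V (LocalState.start fun _ => .num 0)).out.length : ℝ) ≤ db.agmBound e ∧
    ((q.joinProgram.exec V (LocalState.start fun _ => .num 0)).steps : ℝ) ≤
      n + 8 + 14 * db.vertices.length + extendCost n m * (1 + db.agmBound e) := by
  set σ₀ : LocalState D n := ⟨Function.update (Function.update (fun _ => .num 0) 0 (.num 1))
    1 (.num 0), fun _ => .num 0, [], [], 3⟩ with hσ₀
  obtain ⟨a1, a2, a3, a4, a5⟩ := exec_setConstants V (m + n) (n + 2) σ₀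
  set σ₁ := (setConstants (m + n) (n + 2)).exec V σ₀ with hσ₁
  obtain ⟨b1, b2, b3, b4, b5⟩ := exec_loadInbox V (db.vertices.map q.sentRow) hin
    (db.nodup_vertices.map q.sentRow_injective) σ₁ (z := m + n) (o := m + n + 1)
    (s := m + n + n + 2) (a5 0 (by omega)) (a5 1 (by omega)) (by omega) (by omega) a1
  set σ₂ := (loadInbox (m + n) (m + n + 1) (m + n + n + 2)).exec V σ₁ with hσ₂
  have hready : Ready m (q.orientedRows db) σ₂ := by
    refine ⟨fun j hj => ?_, _, b1, fun i x y => db.mem_sentRows_iff q i x y⟩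
    rw [b4 _ (by omega), a5 j hj]
  obtain ⟨c1, L, c2, c3, c4, c5⟩ := exec_extendAll V q.lo_lt_hi q.hi_lt hcover.1
    hcover.one_le_sum m 0 (Nat.zero_add m) σ₂ hready
  have hex : q.joinProgram.exec V (LocalState.start fun _ => .num 0) =
      (extendAll m q.lo q.hi m 0).exec V σ₂ := by
    rw [hσ₂, hσ₁]
    simp [BinaryQuery.joinProgram, BinaryQuery.localJoin, VertexProgram.exec, LocalState.start,
      LocalState.set, LocalState.tick, hV, hσ₀]
  have hw : weight q.lo q.hi (q.orientedRows db) e 0 σ₂.reg ≤ db.agmBound e := by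
    refine weight_le_residualBound.trans_eq ?_
    rw [residualBound_zero]
    simp only [q.card_orientedRows db]
    rfl
  rw [hex]
  have hout : ((extendAll m q.lo q.hi m 0).exec V σ₂).out = L := by
    rw [c2, b3, a3]
    rfl
  refine ⟨?_, fun l => ?_, ?_, ?_⟩
  · rw [c1.sent, b2, a2]
  · rw [hout, c3, q.isExtension_zero_iff db hcover]
  · rw [hout]
    exact c4.trans hw
  · rw [a4, List.length_map] at b5
    -- Three steps for the superstep test, `n + 3` for the constants, two to enter the loading loop,
    -- and 14 per message.
    have h1 : (σ₂.steps : ℝ) ≤ n + 8 + 14 * db.vertices.length := by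
      have : σ₂.steps ≤ n + 8 + 14 * db.vertices.length := by
        simp only [hσ₀] at b5
        omega
      exact_mod_cast this
    have h2 := mul_le_mul_of_nonneg_left hw (Nat.cast_nonneg (α := ℝ) (extendCost n m))
    linarith

end Exec

/-! ### The global run -/

namespace BSPConfig

variable {D : Type u} [DecidableEq D] {n m : ℕ} (q : BinaryQuery n m) (db : Database D n)

theorem run_one : ∃ c : ℕ, c ≤ (2 * n + 8) * db.vertices.length ∧
    run q db q.joinProgram 1 = ⟨1, fun _ _ => .num 0,
      fun v => if v = .aggregator then
        (db.vertices.map q.sentRow).map fun p => [p.1, p.2.1, p.2.2] else [],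
      db.vertices.length, c, []⟩ := by
  have hact : (initial : BSPConfig D n).active db = db.vertices := by simp [active, initial]
  have hrun := fun v => exec_joinProgram_zero
    (⟨0, v, db.edges q v, []⟩ : LocalView D n m) q rfl fun _ => .num 0
  have hmsg : (initial : BSPConfig D n).messages q db q.joinProgram = db.vertices.map fun v =>
      (.aggregator, [(q.sentRow v).1, (q.sentRow v).2.1, (q.sentRow v).2.2]) := by
    rw [messages, hact, List.map_eq_flatMap]
    exact congrArg (fun f => List.flatMap f db.vertices) (funext fun v => (hrun v).2.2.2)
  refine ⟨(db.vertices.map fun v => (runVertex q db q.joinProgram initial v).steps).sum, ?_, ?_⟩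
  · refine (List.sum_le_card_nsmul _ (2 * n + 8) ?_).trans_eq ?_
    · simp only [List.mem_map]
      rintro _ ⟨v, -, rfl⟩
      exact (hrun v).2.2.1
    · rw [List.length_map, smul_eq_mul, mul_comm]
  · change step q db q.joinProgram initial = _
    rw [step, hmsg, hact]
    congr 1
    · funext v
      split_ifs
      · exact (hrun v).1
      · rfl
    · funext v
      by_cases hv : v = .aggregator
      · subst hv
        simp [List.filter_map, Function.comp_def]
      · simp [List.filter_map, Function.comp_def, hv, Ne.symm hv]
    · simp [initial]
    · simp [initial]
    · change [] ++ _ = _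
      rw [List.nil_append, List.flatMap_eq_nil_iff]
      exact fun v _ => (hrun v).2.1

/-- After the first superstep only the aggregation vertex has mail, and its memory is still clear.
It sends nothing, so no vertex is active afterwards. -/
theorem run_two {e : Fin n → ℝ} (hcover : q.IsFractionalEdgeCover e) :
    (run q db q.joinProgram 2).Halted db ∧ (run q db q.joinProgram 2).OutputsJoin q db ∧
    ((run q db q.joinProgram 2).output.length : ℝ) ≤ db.agmBound e ∧
    (run q db q.joinProgram 2).communication = db.vertices.length ∧
    ((run q db q.joinProgram 2).computation : ℝ) ≤ n + 8 + (2 * n + 22) * db.vertices.length +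
      extendCost n m * (1 + db.agmBound e) := by
  obtain ⟨c, hc, h1⟩ := run_one q db
  have hstep : run q db q.joinProgram 2 = step q db q.joinProgram (run q db q.joinProgram 1) := rfl
  rw [hstep, h1]
  set c₁ : BSPConfig D n := ⟨1, fun _ _ => .num 0, fun v => if v = .aggregator then
    (db.vertices.map q.sentRow).map fun p => [p.1, p.2.1, p.2.2] else [],
    db.vertices.length, c, []⟩ with hc₁
  have hne : db.vertices ≠ [] := by simp [Database.vertices]
  have hact : c₁.active db = [.aggregator] := by
    have hp : ∀ v : Vertex D n, (c₁.time = 0 ∨ c₁.inbox v ≠ []) ↔ v = .aggregator := by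
      intro v
      by_cases hv : v = .aggregator <;> simp [hc₁, hv, hne]
    have hdec : c₁.active db = db.vertices.filter fun v => v = .aggregator :=
      List.filter_congr fun v _ => by simp only [hp]
    rw [hdec, Database.vertices, List.filter_append, List.filter_eq_nil_iff.2]
    · simp
    · simp only [List.mem_append, List.mem_flatMap, List.mem_map]
      rintro _ (⟨_, _, _, _, rfl⟩ | ⟨_, _, rfl⟩) <;> simp
  obtain ⟨g1, g2, g3, g4⟩ := exec_joinProgram_one
    (⟨1, .aggregator, db.edges q .aggregator, c₁.inbox .aggregator⟩ : LocalView D n m) q hcover db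
    rfl (by simp [hc₁])
  have hrun : runVertex q db q.joinProgram c₁ .aggregator = q.joinProgram.exec
    (⟨1, .aggregator, db.edges q .aggregator, c₁.inbox .aggregator⟩ : LocalView D n m)
    (LocalState.start fun _ => .num 0) := rfl
  rw [← hrun] at g1 g2 g3 g4
  have hmsg : c₁.messages q db q.joinProgram = [] := by simp [messages, hact, g1]
  have hout : (step q db q.joinProgram c₁).output =
      (runVertex q db q.joinProgram c₁ .aggregator).out := by
    rw [step, hact]
    simp [hc₁]
  refine ⟨?_, ?_, ?_, ?_, ?_⟩
  · simp [Halted, active, step, hmsg]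
  · rw [OutputsJoin, hout]
    ext l
    rw [Set.mem_ofPred_eq, g2, Set.mem_image]
  · rw [hout]
    exact g3
  · rw [step, hmsg]
    simp [hc₁]
  · have hcomp : (step q db q.joinProgram c₁).computation =
        c + (runVertex q db q.joinProgram c₁ .aggregator).steps := by
      rw [step, hact]
      simp [hc₁]
    have hc' : (c : ℝ) ≤ (2 * n + 8) * db.vertices.length := by exact_mod_cast hc
    rw [hcomp]
    push_cast
    linarith

end BSPConfig

/-! ### Size bound and final constants -/

theorem Database.agmBound_nonneg {D : Type u} {n : ℕ} (db : Database D n) (e : Fin n → ℝ) :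
    0 ≤ db.agmBound e :=
  Finset.prod_nonneg fun _ _ => Real.rpow_nonneg (Nat.cast_nonneg _) _

/-- The bound on the size of the join. -/
theorem BinaryQuery.join_finite_and_ncard_le {n m : ℕ} (q : BinaryQuery n m) {e : Fin n → ℝ}
    (hcover : q.IsFractionalEdgeCover e) {D : Type u} (db : Database D n) :
    (q.join db).Finite ∧ ((q.join db).ncard : ℝ) ≤ db.agmBound e := by
  classical
  -- The output list enumerates an injective image of the join and has length at most AGM.
  obtain ⟨-, hout, hlen, -⟩ := BSPConfig.run_two q db hcover
  set L := (BSPConfig.run q db q.joinProgram 2).output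
  have hinj : Function.Injective
      (fun t : Fin m → D => List.ofFn fun a => (Word.val (t a) : Word D n)) := by
    intro t t' h
    funext a
    have := congrFun (List.ofFn_injective h) a
    simpa using this
  have himg : (fun t : Fin m → D => List.ofFn fun a => (Word.val (t a) : Word D n)) '' q.join db =
      (L.toFinset : Set _) := by
    rw [← hout]
    ext l
    simp [L]
  refine ⟨Set.Finite.of_finite_image (himg ▸ Finset.finite_toSet _) hinj.injOn, ?_⟩
  refine le_trans ?_ hlen
  rw [← Set.ncard_image_of_injective _ hinj, himg, Set.ncard_coe_finset]
  exact_mod_cast List.toFinset_card_le L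

theorem mainTheorem2 {n m : ℕ} (q : BinaryQuery n m) (e : Fin n → ℝ)
    (hcover : q.IsFractionalEdgeCover e) (hhalf : BinaryQuery.IsHalfIntegral e)
    (dec : q.CycleStarDecomposition e) :
    (∀ (D : Type u) (db : Database D n),
      (q.join db).Finite ∧ ((q.join db).ncard : ℝ) ≤ db.agmBound e) ∧
    ∃ (P : VertexProgram) (C : ℕ), ∀ (D : Type u) [DecidableEq D] (db : Database D n),
      ∃ k : ℕ, (BSPConfig.run q db P k).Halted db ∧ (BSPConfig.run q db P k).OutputsJoin q db ∧
        ((BSPConfig.run q db P k).communication : ℝ) ≤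
          C * (db.agmBound e + db.inputSize + 1) ∧
        ((BSPConfig.run q db P k).computation : ℝ) ≤
          C * (db.agmBound e + db.inputSize + 1) ∧
        ((∀ i, 1 ≤ db.card i ∧ (db.card i : ℝ) ≤ db.agmBound e) →
          ((BSPConfig.run q db P k).communication : ℝ) ≤ C * db.agmBound e ∧
          ((BSPConfig.run q db P k).computation : ℝ) ≤ C * db.agmBound e) := by
  -- The first factor of the constant serves for the bound with `IN`. The factor `n + 2` turns AGM +
  -- IN + 1 into a multiple of AGM, using `IN ≤ n * AGM` and `1 ≤ AGM`.
  refine ⟨fun D db => q.join_finite_and_ncard_le hcover db, q.joinProgram,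
    (6 * n + 74 + extendCost n m) * (n + 2), fun D _ db => ⟨2, ?_⟩⟩
  obtain ⟨h1, h2, -, h3, h4⟩ := BSPConfig.run_two q db hcover
  have hA := db.agmBound_nonneg e
  have hv : (db.vertices.length : ℝ) ≤ 3 * db.inputSize + 1 := by
    exact_mod_cast db.length_vertices_le
  have hI : (0 : ℝ) ≤ db.inputSize := Nat.cast_nonneg _
  have hn : (0 : ℝ) ≤ n := Nat.cast_nonneg _
  have hX : (0 : ℝ) ≤ extendCost n m := Nat.cast_nonneg _
  set K : ℝ := 6 * n + 74 + extendCost n m with hK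
  have hS : 0 ≤ db.agmBound e + db.inputSize + 1 := by linarith
  have hcomm : ((BSPConfig.run q db q.joinProgram 2).communication : ℝ) ≤
      K * (db.agmBound e + db.inputSize + 1) := by
    rw [h3]
    refine hv.trans ?_
    have : 3 * (db.agmBound e + db.inputSize + 1) ≤ K * (db.agmBound e + db.inputSize + 1) :=
      mul_le_mul_of_nonneg_right (by linarith) hS
    linarith
  have hcomp : ((BSPConfig.run q db q.joinProgram 2).computation : ℝ) ≤
      K * (db.agmBound e + db.inputSize + 1) := by
    refine h4.trans ?_
    have e1 := mul_le_mul_of_nonneg_left hv (by linarith : (0 : ℝ) ≤ 2 * n + 22)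
    have e2 := mul_nonneg hX hI
    have e3 := mul_nonneg hn hA
    have e4 := mul_nonneg hn hI
    rw [hK]
    nlinarith
  have hKS : K * (db.agmBound e + db.inputSize + 1) ≤
      K * (n + 2) * (db.agmBound e + db.inputSize + 1) := by
    refine mul_le_mul_of_nonneg_right (le_mul_of_one_le_right ?_ ?_) hS <;> linarith
  have hcast : (((6 * n + 74 + extendCost n m) * (n + 2) : ℕ) : ℝ) = K * (n + 2) := by
    push_cast
    rfl
  rw [hcast]
  refine ⟨h1, h2, hcomm.trans hKS, hcomp.trans hKS, fun h => ?_⟩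
  have hA1 : 1 ≤ db.agmBound e := by
    rw [Database.agmBound, ← Finset.prod_const_one (s := Finset.univ (α := Fin n))]
    refine Finset.prod_le_prod (fun _ _ => zero_le_one) fun i _ =>
      Real.one_le_rpow ?_ (hcover.1 i)
    exact_mod_cast (h i).1
  have hIA : (db.inputSize : ℝ) ≤ n * db.agmBound e := by
    rw [Database.inputSize, Nat.cast_sum]
    refine (Finset.sum_le_sum fun i _ => (h i).2).trans_eq ?_
    simp
  have hfin : K * (db.agmBound e + db.inputSize + 1) ≤ K * (n + 2) * db.agmBound e := by
    rw [mul_assoc]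
    exact mul_le_mul_of_nonneg_left (by linarith) (by linarith)
  exact ⟨hcomm.trans hfin, hcomp.trans hfin⟩
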